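/- **Theorem.** For every $n\ge 1$, the problem $\mathsf{Con}_n$ of finding a connectedness component of a non-empty closed subset of $[0,1]^n$ is strongly Weihrauch equivalent to Weak Kőnig's Lemma: $\mathsf{Con}_n\equiv_{\mathrm{sW}}\mathsf{WKL}$. Here the notions are as follows. * A *represented space* is a set $X$ with a surjective partial map $\delta_X:\subseteq\mathbb N^{\mathbb N}\to X$; if $\delta_X(p)=x$, then $p$ is a *name* of $x$. A *multi-valued function* $f:\subseteq X\rightrightarrows Y$ assigns to each $x\in X$ a set $f(x)\subseteq Y$, and $\operatorname{dom}(f)=\{x: f(x)\neq\emptyset\}$. A partial function $F:\subseteq\mathbb N^{\mathbb N}\to\mathbb N^{\mathbb N}$ is a *realizer* of $f$ if for every name $p$ of a point $x\in\operatorname{dom}(f)$ the value $F(p)$ is defined and is a name of some element of $f(x)$. One writes $f\le_{\mathrm{sW}}g$ if there are computable partial functions $K,H:\subseteq\mathbb N^{\mathbb N}\to\mathbb N^{\mathbb N}$ such that $K\circ G\circ H$ is a realizer of $f$ for every realizer $G$ of $g$; and $f\equiv_{\mathrm{sW}}g$ means $f\le_{\mathrm{sW}}g$ and $g\le_{\mathrm{sW}}f$.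 * $\mathcal A_n$ is the space of non-empty closed subsets of $[0,1]^n$ with negative information: a name of $A$ is a sequence $p\in\mathbb N^{\mathbb N}$ with $A=[0,1]^n\setminus\bigcup_{i}B_{p(i)}$, where $(B_k)_k$ is a standard enumeration of the open balls of $[0,1]^n$ (maximum norm) with rational center and non-negative rational radius. * $\mathsf{Con}_n:\mathcal A_n\rightrightarrows\mathcal A_n$ maps $A$ to the set of all connectedness components of $A$, that is, of all connected subsets of $A$ that are not included in any larger connected subset of $A$. * $\mathsf{WKL}$ maps an infinite binary tree $T\subseteq\{0,1\}^*$ (a set of words closed under prefixes, given by its characteristic function with respect to a standard coding of words by numbers) to the set of its infinite paths $x\in\{0,1\}^{\mathbb N}$ (Cantor space, where a point is its own name). -/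

import Mathlib

namespace CompAnalysis

/-! ## Computability on Baire space -/

/-- Baire space, the set of all sequences of natural numbers. -/
abbrev Baire : Type := ℕ → ℕ

/-- The prefix `x 0, …, x (k - 1)` of length `k` of a sequence. -/
def initSeg {α : Type*} (x : ℕ → α) (k : ℕ) : List α := (List.range k).map x

/-- Computability of a partial function `F` on Baire space: there is a computable word function
`h`, monotone for the prefix order, such that for every `p` in the domain of `F` the words
`h (initSeg p k)` (the output that a type-2 machine has written after reading `k` input symbols)
converge to the infinite sequence `F p`. Restrictions of computable functions are computable. -/
def ComputableOnBaire (F : Baire →. Baire) : Prop :=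
  ∃ h : List ℕ → List ℕ, Computable h ∧
    (∀ u v : List ℕ, u <+: v → h u <+: h v) ∧
    ∀ p q : Baire, q ∈ F p → ∀ m : ℕ, ∃ k : ℕ, (h (initSeg p k))[m]? = some (q m)

/-! ## Represented spaces and strong Weihrauch reducibility -/

/-- A represented space: a set with a surjective partial map `δ` from Baire space onto it, given by
its graph, so `Names p x` means that `p` lies in the domain of `δ` and `δ p = x`. -/
class RepresentedSpace (X : Type*) where
  Names : Baire → X → Prop
  unique : ∀ {p : Baire} {x y : X}, Names p x → Names p y → x = y
  surjective : ∀ x : X, ∃ p : Baire, Names p x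

/-- Multi-valued partial functions; `f x` is the set of values at `x`, and the domain of `f` is the
set of all `x` for which `f x` is nonempty. -/
abbrev MultiMap (X Y : Type*) : Type _ := X → Set Y

section Reducibility

variable {X Y Z W : Type*} [RepresentedSpace X] [RepresentedSpace Y] [RepresentedSpace Z]
  [RepresentedSpace W]

/-- `F` is a realizer of `f`: whenever `p` is a name of a point `x` in the domain of `f`, then `F p`
is defined and is a name of some element of `f x`. -/
def IsRealizer (F : Baire →. Baire) (f : MultiMap X Y) : Prop :=
  ∀ (p : Baire) (x : X), RepresentedSpace.Names p x → (f x).Nonempty →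
    ∃ q ∈ F p, ∃ y ∈ f x, RepresentedSpace.Names q y

/-- Strong Weihrauch reducibility: there are computable partial functions `K` and `H` on Baire space
such that `K ∘ G ∘ H` is a realizer of `f` for every realizer `G` of `g`. -/
def StrongWeihrauchReducible (f : MultiMap X Y) (g : MultiMap Z W) : Prop :=
  ∃ K H : Baire →. Baire, ComputableOnBaire K ∧ ComputableOnBaire H ∧
    ∀ G : Baire →. Baire, IsRealizer G g → IsRealizer (K.comp (G.comp H)) f

/-- Strong Weihrauch equivalence. -/
def StrongWeihrauchEquiv (f : MultiMap X Y) (g : MultiMap Z W) : Prop :=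
  StrongWeihrauchReducible f g ∧ StrongWeihrauchReducible g f

end Reducibility

/-- A subspace of a represented space carries the restricted representation. -/
instance {X : Type*} [RepresentedSpace X] (P : X → Prop) : RepresentedSpace {x : X // P x} where
  Names p x := RepresentedSpace.Names p x.1
  unique h h' := Subtype.ext (RepresentedSpace.unique h h')
  surjective x := RepresentedSpace.surjective x.1

/-! ## Closed subsets of the unit cube, with negative information -/

/-- The unit cube `[0,1]^n`; its metric is the one of the maximum norm. -/
abbrev Cube (n : ℕ) : Type := Fin n → unitInterval

/-- An enumeration of the non-negative rational numbers, as real numbers. -/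
noncomputable def ratCode (k : ℕ) : ℝ := (k.unpair.1 : ℝ) / ((k.unpair.2 : ℝ) + 1)

/-- An enumeration of the rational points of `[0,1]^n`: the number `m` codes a finite list of natural
numbers, whose `i`-th entry codes the `i`-th coordinate (cut off at `1`). -/
noncomputable def ratPoint (n m : ℕ) : Cube n := fun i =>
  Set.projIcc (0 : ℝ) 1 zero_le_one (ratCode ((Denumerable.ofNat (List ℕ) m).getD i 0))

/-- The standard enumeration of the open balls of `[0,1]^n` with rational center and rational
radius. As usual the radius `0` is included, so that the empty set is one of the balls. -/
noncomputable def ratBall (n k : ℕ) : Set (Cube n) :=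
  Metric.ball (ratPoint n k.unpair.1) (ratCode k.unpair.2)

theorem exists_ratCode {a b : ℝ} (ha : 0 ≤ a) (hab : a < b) : ∃ k, a < ratCode k ∧ ratCode k < b := by
  obtain ⟨q, h1, h2⟩ := exists_rat_btwn hab
  have hq : 0 < q := by exact_mod_cast ha.trans_lt h1
  refine ⟨Nat.pair q.num.toNat (q.den - 1), ?_⟩
  have hd : ((q.den - 1 : ℕ) : ℝ) + 1 = q.den := by
    have : q.den - 1 + 1 = q.den := Nat.sub_add_cancel q.pos
    exact_mod_cast this
  have hn : ((q.num.toNat : ℕ) : ℝ) = (q.num : ℝ) := by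
    have : ((q.num.toNat : ℕ) : ℤ) = q.num := Int.toNat_of_nonneg (Rat.num_nonneg.2 hq.le)
    exact_mod_cast this
  have : ratCode (Nat.pair q.num.toNat (q.den - 1)) = q := by
    rw [ratCode, Nat.unpair_pair, hd, hn, Rat.cast_def]
  rw [this]
  exact ⟨h1, h2⟩

theorem exists_ratPoint {n : ℕ} (x : Cube n) {ε : ℝ} (hε : 0 < ε) :
    ∃ m, dist x (ratPoint n m) < ε := by
  have h : ∀ i, ∃ k, (x i : ℝ) < ratCode k ∧ ratCode k < x i + ε := fun i =>
    exists_ratCode (x i).2.1 (by linarith)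
  choose c hc using h
  refine ⟨Encodable.encode (List.ofFn c), (dist_pi_lt_iff hε).2 fun i => ?_⟩
  have hi : ((Denumerable.ofNat (List ℕ) (Encodable.encode (List.ofFn c))).getD i 0) = c i := by
    simp
  have hx : x i = Set.projIcc (0 : ℝ) 1 zero_le_one (x i : ℝ) := (Set.projIcc_val _ _).symm
  rw [ratPoint, hi, hx]
  refine (LipschitzWith.dist_le_mul (LipschitzWith.projIcc zero_le_one) _ _).trans_lt ?_
  rw [Real.dist_eq, NNReal.coe_one, one_mul, abs_lt]
  constructor <;> linarith [(hc i).1, (hc i).2]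

theorem exists_ratBall {n : ℕ} {U : Set (Cube n)} (hU : IsOpen U) {x : Cube n} (hx : x ∈ U) :
    ∃ k, x ∈ ratBall n k ∧ ratBall n k ⊆ U := by
  obtain ⟨ε, hε, h⟩ := Metric.isOpen_iff.1 hU x hx
  obtain ⟨m, hm⟩ := exists_ratPoint x (show 0 < ε / 4 by linarith)
  obtain ⟨r, hr1, hr2⟩ := exists_ratCode (show 0 ≤ ε / 4 by linarith)
    (show ε / 4 < ε / 2 by linarith)
  refine ⟨Nat.pair m r, ?_, fun y hy => h ?_⟩
  · rw [ratBall, Nat.unpair_pair, Metric.mem_ball]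
    exact hm.trans hr1
  · rw [ratBall, Nat.unpair_pair, Metric.mem_ball] at hy
    rw [Metric.mem_ball]
    have := dist_triangle_right y x (ratPoint n m)
    dsimp only at hy
    linarith

/-- Negative information: `p` is a name of the closed set `A` if `A` is the complement of the union
of all the balls listed by `p`. -/
instance (n : ℕ) : RepresentedSpace (TopologicalSpace.Closeds (Cube n)) where
  Names p A := (A : Set (Cube n)) = (⋃ i : ℕ, ratBall n (p i))ᶜ
  unique h h' := SetLike.coe_injective (h.trans h'.symm)
  surjective A := by
    classical
    refine ⟨fun k => if ratBall n k ⊆ (A : Set (Cube n))ᶜ then k else Nat.pair 0 (Nat.pair 0 0), ?_⟩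
    have h0 : ratBall n (Nat.pair 0 (Nat.pair 0 0)) = ∅ := by
      simp [ratBall, ratCode]
    rw [eq_compl_comm]
    refine Set.Subset.antisymm (Set.iUnion_subset fun k => ?_) fun x hx => ?_
    · dsimp only
      split_ifs with hk
      · exact hk
      · rw [h0]
        exact Set.empty_subset _
    · obtain ⟨k, hxk, hk⟩ := exists_ratBall A.isClosed.isOpen_compl hx
      refine Set.mem_iUnion.2 ⟨k, ?_⟩
      dsimp only
      rwa [if_pos hk]

/-- The represented space of nonempty closed subsets of `[0,1]^n`. -/
abbrev NonemptyClosed (n : ℕ) : Type :=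
  {A : TopologicalSpace.Closeds (Cube n) // (A : Set (Cube n)).Nonempty}

/-- `C` is a connectedness component of `A`: a connected subset of `A` that is not included in any
larger connected subset of `A` (here the empty set counts as connected). -/
def IsConnectednessComponent {X : Type*} [TopologicalSpace X] (C A : Set X) : Prop :=
  Maximal (fun S : Set X => S ⊆ A ∧ IsPreconnected S) C

/-- The problem of finding a connectedness component of a nonempty closed subset of `[0,1]^n`. -/
def ConComp (n : ℕ) : MultiMap (NonemptyClosed n) (NonemptyClosed n) := fun A =>
  {C | IsConnectednessComponent (C.1 : Set (Cube n)) (A.1 : Set (Cube n))}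

/-! ## Weak König's Lemma -/

/-- Cantor space, with the identity as representation. -/
instance : RepresentedSpace (ℕ → Bool) where
  Names p x := ∀ k, p k = (x k).toNat
  unique {p x y} h h' := funext fun k => by
    have := (h k).symm.trans (h' k)
    revert this
    cases x k <;> cases y k <;> simp
  surjective x := ⟨fun k => (x k).toNat, fun _ => rfl⟩

/-- Binary trees: sets of binary words closed under prefixes. -/
structure BinaryTree where
  carrier : Set (List Bool)
  prefix_closed : ∀ u v : List Bool, u <+: v → v ∈ carrier → u ∈ carrier

/-- Binary trees are represented by their characteristic functions (words are coded by numbers). -/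
instance : RepresentedSpace BinaryTree where
  Names p T := ∀ k : ℕ, ((∃ w ∈ T.carrier, Encodable.encode w = k) → p k = 1) ∧
    ((¬ ∃ w ∈ T.carrier, Encodable.encode w = k) → p k = 0)
  unique {p S T} hS hT := by
    have key : ∀ {S T : BinaryTree}, (∀ k : ℕ,
        ((∃ w ∈ S.carrier, Encodable.encode w = k) → p k = 1) ∧
        ((¬ ∃ w ∈ S.carrier, Encodable.encode w = k) → p k = 0)) → (∀ k : ℕ,
        ((∃ w ∈ T.carrier, Encodable.encode w = k) → p k = 1) ∧
        ((¬ ∃ w ∈ T.carrier, Encodable.encode w = k) → p k = 0)) → S.carrier ⊆ T.carrier := by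
      intro S T hS hT w hw
      by_contra hwT
      have h1 := (hS (Encodable.encode w)).1 ⟨w, hw, rfl⟩
      have h0 := (hT (Encodable.encode w)).2 (by
        rintro ⟨v, hv, hvw⟩
        exact hwT (Encodable.encode_injective hvw ▸ hv))
      omega
    cases S
    cases T
    congr
    exact Set.Subset.antisymm (key hS hT) (key hT hS)
  surjective T := by
    classical
    refine ⟨fun k => if ∃ w ∈ T.carrier, Encodable.encode w = k then 1 else 0, fun k => ?_⟩
    exact ⟨fun h => if_pos h, fun h => if_neg h⟩

/-- The represented space of infinite binary trees. -/
abbrev InfiniteBinaryTree : Type := {T : BinaryTree // T.carrier.Infinite}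

/-- Weak König's Lemma as a problem: find an infinite path of a given infinite binary tree. -/
def WKL : MultiMap InfiniteBinaryTree (ℕ → Bool) := fun T =>
  {x | ∀ k : ℕ, initSeg x k ∈ T.1.carrier}

end CompAnalysis

open CompAnalysis

/-! Components from paths. At each level `k` the cube is covered by finitely many cells, balls of
radius `2 / 2 ^ k` around a grid of mesh `1 / 2 ^ k`, and a sequence of bits selects some of them. A
cell is alive at level `k` if the first `k` balls in the name of `A` do not yet show that it misses
`A`. A selection describes a component of `A` as soon as, at every level, it is nonempty, contains
only alive cells, contains every alive cell touching one of its cells, cannot be split into two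
parts that do not touch, and has each cell of the next level inside one of its own
(`isConnectednessComponent_of_approximation`). Indeed, by compactness the unions of the selected
closed cells shrink to a nonempty set `C`. A gap in `C` would split the selection at a fine level,
and no connected subset of `A` leaves the selected cells, since these are separated from the other
alive cells.

Every violation of these conditions shows in finite prefixes of the bits and of the name, so the
good selections are the paths of a tree computable from the name. The tree is infinite: for any `a ∈
A`, the cells linked with `a` by chains of touching alive cells form a good selection
(`not_forbidden_of_chainComponent`). Finally `C` is the complement of the unselected open cells, so
a name of `C` is obtained from the path alone, as a strong reduction demands.

Paths from components. The paths of a tree are placed on the diagonal of the cube by means of the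
Cantor set. The image is closed, and by compactness its complement can be listed from the tree
(`image_paths_eq`). It is totally disconnected, so a component is a single point; a name of that
singleton eventually excludes, again by compactness, all words with a wrong `m`-th bit
(`exists_decidesEntry`), and this yields the path without looking at the tree.

All four functionals have the form `pointwise g` with `g` primitive recursive on prefixes. -/

namespace CompAnalysis

/-! ### Prefixes of sequences -/

section InitSeg

variable {α : Type*}

@[simp] theorem length_initSeg (x : ℕ → α) (k : ℕ) : (initSeg x k).length = k := by
  simp [initSeg]

theorem getElem?_initSeg (x : ℕ → α) (k m : ℕ) :
    (initSeg x k)[m]? = if m < k then some (x m) else none := by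
  split_ifs with h <;> simp [initSeg, h]

theorem getElem?_initSeg_eq_some {x : ℕ → α} {k m : ℕ} {a : α} :
    (initSeg x k)[m]? = some a ↔ m < k ∧ x m = a := by
  rw [getElem?_initSeg]
  split_ifs with h <;> simp [h]

theorem take_initSeg (x : ℕ → α) {j k : ℕ} (h : j ≤ k) : (initSeg x k).take j = initSeg x j := by
  simp [initSeg, ← List.map_take, List.take_range, h]

theorem mem_initSeg {x : ℕ → α} {k : ℕ} {a : α} : a ∈ initSeg x k ↔ ∃ i < k, x i = a := by
  simp [initSeg]

theorem initSeg_succ (x : ℕ → α) (k : ℕ) : initSeg x (k + 1) = initSeg x k ++ [x k] := by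
  simp [initSeg, List.range_succ]

end InitSeg

/-! ## Partial functions on Baire space computed entry by entry -/

/-- The value found first when the prefixes of `u` are fed to `g`. -/
def firstValue (g : List ℕ → ℕ → Option ℕ) (u : List ℕ) (m : ℕ) : Option ℕ :=
  ((List.range (u.length + 1)).filterMap fun k => g (u.take k) m).head?

/-- One step of writing output: the next entry is appended as soon as it is known. -/
def writeStep (g : List ℕ → ℕ → Option ℕ) (u acc : List ℕ) : List ℕ :=
  match firstValue g u acc.length with
  | some a => acc ++ [a]
  | none => acc

/-- The word function which writes the entries found by `g`, in their order. -/
def writeWord (g : List ℕ → ℕ → Option ℕ) (u : List ℕ) : List ℕ :=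
  (writeStep g u)^[u.length] []

/-- Extending the input only appends candidates behind the old ones, so the head is stable even if
`g` contradicts itself on longer prefixes. -/
theorem firstValue_mono {g : List ℕ → ℕ → Option ℕ} {u v : List ℕ} (h : u <+: v) {m a : ℕ}
    (ha : firstValue g u m = some a) : firstValue g v m = some a := by
  obtain ⟨t, rfl⟩ := h
  rw [firstValue] at ha ⊢
  have e : (List.range (u.length + 1)).filterMap (fun k => g ((u ++ t).take k) m) =
      (List.range (u.length + 1)).filterMap fun k => g (u.take k) m := by
    refine List.filterMap_congr fun k hk => ?_
    rw [List.take_append_of_le_length (by simpa [Nat.lt_succ_iff] using hk)]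
  rw [List.length_append, Nat.add_right_comm, List.range_add, List.filterMap_append, e,
    List.head?_append, ha]
  rfl

theorem getElem?_writeStep_iterate {g : List ℕ → ℕ → Option ℕ} {u : List ℕ} (i : ℕ) {m a : ℕ}
    (h : ((writeStep g u)^[i] [])[m]? = some a) : firstValue g u m = some a := by
  induction i generalizing a with
  | zero => simp at h
  | succ i ih =>
    rw [Function.iterate_succ_apply'] at h
    generalize (writeStep g u)^[i] [] = acc at h ih
    rw [writeStep] at h
    split at h
    · next b hb =>
      rw [List.getElem?_append] at h
      split_ifs at h with hm
      · exact ih h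
      · rw [List.getElem?_eq_some_iff] at h
        obtain ⟨h1, h2⟩ := h
        simp only [List.length_singleton] at h1
        have : m = acc.length := by omega
        subst this
        simp at h2
        rw [hb, h2]
    · exact ih h

/-- Writing stalls at the first unknown entry and never resumes on the same input, because the
accumulator stays unchanged. -/
theorem length_writeStep_iterate (g : List ℕ → ℕ → Option ℕ) (u : List ℕ) (i : ℕ) :
    ((writeStep g u)^[i] []).length = i ∨
      firstValue g u ((writeStep g u)^[i] []).length = none := by
  induction i with
  | zero => simp
  | succ i ih =>
    rw [Function.iterate_succ_apply']
    generalize (writeStep g u)^[i] [] = acc at ih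
    rw [writeStep]
    split
    · next b hb =>
      left
      rcases ih with ih | ih
      · simp [ih]
      · rw [ih] at hb
        cases hb
    · next hb => exact Or.inr hb

/-- Both words consist of first values, which persist from `u` to `v`. The output for `v` cannot be
shorter: it would have stalled at an entry already known from `u`, or have run for fewer than
`u.length` steps. -/
theorem writeWord_mono (g : List ℕ → ℕ → Option ℕ) {u v : List ℕ} (h : u <+: v) :
    writeWord g u <+: writeWord g v := by
  have key : ∀ {m a}, (writeWord g u)[m]? = some a → firstValue g v m = some a :=
    fun hm => firstValue_mono h (getElem?_writeStep_iterate _ hm)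
  have hlu : (writeWord g u).length ≤ u.length := by
    have : ∀ i, ((writeStep g u)^[i] []).length ≤ i := by
      intro i
      induction i with
      | zero => simp
      | succ i ih =>
        rw [Function.iterate_succ_apply', writeStep]
        split
        · simpa using ih
        · omega
    exact this _
  have hle : (writeWord g u).length ≤ (writeWord g v).length := by
    by_contra! hlt
    rcases length_writeStep_iterate g v v.length with h1 | h1
    · have := h.length_le
      rw [writeWord, h1] at hlt
      omega
    · change firstValue g v (writeWord g v).length = none at h1
      rw [key (List.getElem?_eq_getElem hlt)] at h1
      cases h1
  rw [List.prefix_iff_getElem?]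
  intro i hi
  have h1 := key (List.getElem?_eq_getElem hi)
  have h2 := getElem?_writeStep_iterate _ (List.getElem?_eq_getElem (hi.trans_le hle))
  rw [List.getElem?_eq_getElem (hi.trans_le hle), ← h1, ← h2]

theorem primrec_firstValue {g : List ℕ → ℕ → Option ℕ} (hg : Primrec₂ g) :
    Primrec₂ (firstValue g) := by
  refine Primrec.list_head?.comp (Primrec.listFilterMap
    (Primrec.list_range.comp (Primrec.succ.comp (Primrec.list_length.comp Primrec.fst))) ?_)
  exact hg.comp (Primrec.list_take.comp Primrec.snd (Primrec.fst.comp Primrec.fst))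
    (Primrec.snd.comp Primrec.fst)

theorem primrec_writeWord {g : List ℕ → ℕ → Option ℕ} (hg : Primrec₂ g) :
    Primrec (writeWord g) := by
  have hstep : Primrec₂ (writeStep g) := by
    refine (Primrec.option_casesOn (o := fun p : List ℕ × List ℕ => firstValue g p.1 p.2.length)
      (f := fun p => p.2) (g := fun p a => p.2 ++ [a]) ?_ Primrec.snd ?_).of_eq ?_
    · exact (primrec_firstValue hg).comp Primrec.fst (Primrec.list_length.comp Primrec.snd)
    · exact Primrec.list_concat.comp (Primrec.snd.comp Primrec.fst) Primrec.snd
    · rintro ⟨u, acc⟩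
      simp only [writeStep]
      cases firstValue g u acc.length <;> rfl
  exact Primrec.nat_iterate Primrec.list_length (Primrec.const []) hstep

/-- The partial function on Baire space whose `m`-th output entry is the first value which `g`
finds for `m` on the prefixes of the input. -/
noncomputable def pointwise (g : List ℕ → ℕ → Option ℕ) : Baire →. Baire := fun p =>
  ⟨∀ m, ∃ k, (firstValue g (initSeg p k) m).isSome,
    fun h m => (firstValue g (initSeg p (h m).choose) m).get (h m).choose_spec⟩

theorem initSeg_prefix {α : Type*} (x : ℕ → α) {j k : ℕ} (h : j ≤ k) :
    initSeg x j <+: initSeg x k := by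
  rw [← take_initSeg x h]
  exact List.take_prefix _ _

theorem computableOnBaire_pointwise {g : List ℕ → ℕ → Option ℕ} (hg : Primrec₂ g) :
    ComputableOnBaire (pointwise g) := by
  refine ⟨writeWord g, (primrec_writeWord hg).to_comp, fun u v h => writeWord_mono g h, ?_⟩
  rintro p q ⟨hdom, rfl⟩ m
  have hk : ∀ i, firstValue g (initSeg p (hdom i).choose) i =
      some ((pointwise g p).get hdom i) := fun i => by
    simp [pointwise]
  obtain ⟨N, hN⟩ : ∃ N, ∀ i ≤ m, (hdom i).choose ≤ N := by
    refine ⟨(Finset.range (m + 1)).sup fun i => (hdom i).choose, fun i hi => ?_⟩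
    exact Finset.le_sup (f := fun i => (hdom i).choose) (by simp; omega)
  -- The bound `N` makes the entries up to `m` known; `m + 1` input symbols give the writer enough
  -- steps to reach entry `m`.
  set K := max N (m + 1)
  have hK : ∀ i ≤ m, firstValue g (initSeg p K) i = some ((pointwise g p).get hdom i) :=
    fun i hi => firstValue_mono (initSeg_prefix p ((hN i hi).trans (le_max_left _ _))) (hk i)
  have hlen : m < (writeWord g (initSeg p K)).length := by
    by_contra! hle
    rcases length_writeStep_iterate g (initSeg p K) (initSeg p K).length with h | h
    · have h2 : m + 1 ≤ K := le_max_right _ _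
      rw [writeWord, h, length_initSeg] at hle
      omega
    · rw [← writeWord, hK _ hle] at h
      cases h
  refine ⟨K, ?_⟩
  have h1 := getElem?_writeStep_iterate _ (List.getElem?_eq_getElem hlen)
  rw [hK m le_rfl] at h1
  rw [h1, ← List.getElem?_eq_getElem hlen]

/-- When no prefix ever yields a wrong answer, it does not matter which one answers first. -/
theorem mem_pointwise {g : List ℕ → ℕ → Option ℕ} {p q : Baire}
    (h1 : ∀ m, ∃ k, g (initSeg p k) m = some (q m))
    (h2 : ∀ m k a, g (initSeg p k) m = some a → a = q m) : q ∈ pointwise g p := by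
  have hval : ∀ m k a, firstValue g (initSeg p k) m = some a → a = q m := by
    intro m k a h
    obtain ⟨j, hj, hja⟩ := List.mem_filterMap.1 (List.mem_of_mem_head? h)
    rw [length_initSeg, List.mem_range] at hj
    rw [take_initSeg p (by omega)] at hja
    exact h2 m j a hja
  have hdom : (pointwise g p).Dom := by
    intro m
    obtain ⟨k, hk⟩ := h1 m
    refine ⟨k, ?_⟩
    rw [firstValue, List.isSome_head?, ← List.length_pos_iff]
    refine List.length_pos_of_mem (a := q m) (List.mem_filterMap.2 ⟨k, ?_, ?_⟩)
    · simp
    · rw [take_initSeg p le_rfl, hk]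
  refine ⟨hdom, funext fun m => hval m _ _ (Option.some_get _).symm⟩

/-- The quantifier over realizers is replaced by one over all names `q` of all solutions `w`. The
reduction is strong because `b` reads only `q`, not `p`. -/
theorem strongWeihrauchReducible_of_pointwise {X Y Z W : Type*} [RepresentedSpace X]
    [RepresentedSpace Y] [RepresentedSpace Z] [RepresentedSpace W] {f : MultiMap X Y}
    {g : MultiMap Z W} {a b : List ℕ → ℕ → Option ℕ} (ha : Primrec₂ a) (hb : Primrec₂ b)
    (h : ∀ p x, RepresentedSpace.Names p x → (f x).Nonempty →
      ∃ t ∈ pointwise a p, ∃ z, RepresentedSpace.Names t z ∧ (g z).Nonempty ∧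
        ∀ q, ∀ w ∈ g z, RepresentedSpace.Names q w →
          ∃ r ∈ pointwise b q, ∃ y ∈ f x, RepresentedSpace.Names r y) :
    StrongWeihrauchReducible f g := by
  refine ⟨pointwise b, pointwise a, computableOnBaire_pointwise hb,
    computableOnBaire_pointwise ha, fun G hG p x hp hx => ?_⟩
  obtain ⟨t, ht, z, htz, hz, hall⟩ := h p x hp hx
  obtain ⟨q, hq, w, hw, hqw⟩ := hG t z htz hz
  obtain ⟨r, hr, y, hy, hry⟩ := hall q w hw hqw
  refine ⟨r, ?_, y, hy, hry⟩
  rw [PFun.comp_apply, PFun.comp_apply]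
  exact Part.mem_bind (Part.mem_bind ht hq) hr

/-! ## Primitive recursive predicates -/

section PrimrecPred

variable {α β : Type*} [Primcodable α] [Primcodable β]

theorem primrecPred_exists_mem {f : α → List β} (hf : Primrec f) {p : α → β → Prop}
    (hp : PrimrecPred fun x : α × β => p x.1 x.2) : PrimrecPred fun a => ∃ b ∈ f a, p a b :=
  (PrimrecRel.exists_mem_list (R := fun b a => p a b)
    (hp.comp (Primrec.pair Primrec.snd Primrec.fst))).comp hf Primrec.id

theorem primrecPred_forall_mem {f : α → List β} (hf : Primrec f) {p : α → β → Prop}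
    (hp : PrimrecPred fun x : α × β => p x.1 x.2) : PrimrecPred fun a => ∀ b ∈ f a, p a b :=
  (PrimrecRel.forall_mem_list (R := fun b a => p a b)
    (hp.comp (Primrec.pair Primrec.snd Primrec.fst))).comp hf Primrec.id

theorem primrecPred_exists_lt {f : α → ℕ} (hf : Primrec f) {p : α → ℕ → Prop}
    (hp : PrimrecPred fun x : α × ℕ => p x.1 x.2) : PrimrecPred fun a => ∃ b < f a, p a b :=
  (primrecPred_exists_mem (Primrec.list_range.comp hf) hp).of_eq (by simp)

theorem primrecPred_forall_lt {f : α → ℕ} (hf : Primrec f) {p : α → ℕ → Prop}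
    (hp : PrimrecPred fun x : α × ℕ => p x.1 x.2) : PrimrecPred fun a => ∀ b < f a, p a b :=
  (primrecPred_forall_mem (Primrec.list_range.comp hf) hp).of_eq (by simp)

theorem primrecPred_mem {f : α → List β} {g : α → β} (hf : Primrec f) (hg : Primrec g) :
    PrimrecPred fun a => g a ∈ f a :=
  (primrecPred_exists_mem hf (p := fun a b => b = g a)
    (Primrec.eq.comp Primrec.snd (hg.comp Primrec.fst))).of_eq (by simp)

theorem primrec_pow : Primrec₂ ((· ^ ·) : ℕ → ℕ → ℕ) :=
  Primrec₂.unpaired'.1 Nat.Primrec.pow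

end PrimrecPred

/-! ## Arithmetic of coded rational numbers -/

theorem ratCode_nonneg (a : ℕ) : 0 ≤ ratCode a := by
  unfold ratCode
  positivity

/-- A code of the sum of two coded rational numbers. -/
def addCode (a b : ℕ) : ℕ :=
  Nat.pair (a.unpair.1 * (b.unpair.2 + 1) + b.unpair.1 * (a.unpair.2 + 1))
    (a.unpair.2 * b.unpair.2 + a.unpair.2 + b.unpair.2)

/-- Codes store the denominator minus one, and `(s + 1) * (t + 1) = (s * t + s + t) + 1`. -/
theorem ratCode_addCode (a b : ℕ) : ratCode (addCode a b) = ratCode a + ratCode b := by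
  simp only [ratCode, addCode, Nat.unpair_pair]
  push_cast
  rw [div_add_div _ _ (by positivity) (by positivity)]
  congr 1 <;> ring

theorem primrec_fst_unpair {α : Type*} [Primcodable α] {f : α → ℕ} (hf : Primrec f) :
    Primrec fun a => (f a).unpair.1 := Primrec.fst.comp (Primrec.unpair.comp hf)

theorem primrec_snd_unpair {α : Type*} [Primcodable α] {f : α → ℕ} (hf : Primrec f) :
    Primrec fun a => (f a).unpair.2 := Primrec.snd.comp (Primrec.unpair.comp hf)

theorem primrec_addCode : Primrec₂ addCode := by
  have a1 : Primrec fun x : ℕ × ℕ => x.1.unpair.1 := primrec_fst_unpair Primrec.fst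
  have a2 : Primrec fun x : ℕ × ℕ => x.1.unpair.2 := primrec_snd_unpair Primrec.fst
  have b1 : Primrec fun x : ℕ × ℕ => x.2.unpair.1 := primrec_fst_unpair Primrec.snd
  have b2 : Primrec fun x : ℕ × ℕ => x.2.unpair.2 := primrec_snd_unpair Primrec.snd
  exact Primrec₂.natPair.comp
    (Primrec.nat_add.comp (Primrec.nat_mul.comp a1 (Primrec.succ.comp b2))
      (Primrec.nat_mul.comp b1 (Primrec.succ.comp a2)))
    (Primrec.nat_add.comp (Primrec.nat_add.comp (Primrec.nat_mul.comp a2 b2) a2) b2)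

theorem ratCode_lt_iff (a b : ℕ) : ratCode a < ratCode b ↔
    a.unpair.1 * (b.unpair.2 + 1) < b.unpair.1 * (a.unpair.2 + 1) := by
  rw [ratCode, ratCode, div_lt_div_iff₀ (by positivity) (by positivity)]
  exact_mod_cast Iff.rfl

theorem primrecPred_ratCode_lt {α : Type*} [Primcodable α] {f g : α → ℕ} (hf : Primrec f)
    (hg : Primrec g) : PrimrecPred fun x => ratCode (f x) < ratCode (g x) := by
  have a1 := primrec_fst_unpair hf
  have a2 := primrec_snd_unpair hf
  have b1 := primrec_fst_unpair hg
  have b2 := primrec_snd_unpair hg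
  refine PrimrecPred.of_eq (Primrec.nat_lt.comp (Primrec.nat_mul.comp a1 (Primrec.succ.comp b2))
      (Primrec.nat_mul.comp b1 (Primrec.succ.comp a2))) fun x => (ratCode_lt_iff _ _).symm

/-- A code of the minimum of a coded rational number and `1`. -/
def clipCode (a : ℕ) : ℕ := Nat.pair (min a.unpair.1 (a.unpair.2 + 1)) a.unpair.2

theorem ratCode_clipCode (a : ℕ) : ratCode (clipCode a) = min 1 (ratCode a) := by
  have h : (0 : ℝ) < (a.unpair.2 : ℝ) + 1 := by positivity
  simp only [ratCode, clipCode, Nat.unpair_pair]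
  push_cast
  rw [min_comm, ← min_div_div_right h.le, div_self h.ne']

theorem primrec_clipCode : Primrec clipCode :=
  Primrec₂.natPair.comp
    (Primrec.nat_min.comp (primrec_fst_unpair Primrec.id)
      (Primrec.succ.comp (primrec_snd_unpair Primrec.id)))
    (primrec_snd_unpair Primrec.id)

/-- A code of a coordinate of a coded point of the cube. -/
def coordCode (m i : ℕ) : ℕ := clipCode ((Denumerable.ofNat (List ℕ) m).getD i 0)

theorem coe_ratPoint (n m : ℕ) (i : Fin n) : (ratPoint n m i : ℝ) = ratCode (coordCode m i) := by
  rw [ratPoint, coordCode, ratCode_clipCode, Set.coe_projIcc]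
  exact max_eq_right (le_min zero_le_one (ratCode_nonneg _))

theorem primrec_coordCode : Primrec₂ coordCode :=
  primrec_clipCode.comp ((Primrec.list_getD 0).comp ((Primrec.ofNat (List ℕ)).comp Primrec.fst)
    Primrec.snd)

/-! ## Coded balls -/

section Balls

variable (n : ℕ)

/-- The center of a coded ball. -/
noncomputable def ballCenter (b : ℕ) : Cube n := ratPoint n b.unpair.1

/-- The radius of a coded ball. -/
noncomputable def ballRadius (b : ℕ) : ℝ := ratCode b.unpair.2

theorem ratBall_eq (b : ℕ) : ratBall n b = Metric.ball (ballCenter n b) (ballRadius b) := rfl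

theorem ballRadius_nonneg (b : ℕ) : 0 ≤ ballRadius b := ratCode_nonneg _

/-- The closed ball with code `a` lies well inside of the open ball with code `b`. -/
def WellInside (a b : ℕ) : Prop :=
  dist (ballCenter n a) (ballCenter n b) + ballRadius a < ballRadius b

/-- The closed balls with codes `a` and `b` are not separated by their radii. -/
def Touches (a b : ℕ) : Prop :=
  dist (ballCenter n a) (ballCenter n b) ≤ ballRadius a + ballRadius b

variable {n}

theorem dist_ballCenter_apply (a b : ℕ) (i : Fin n) :
    dist (ballCenter n a i) (ballCenter n b i) =
      |ratCode (coordCode a.unpair.1 i) - ratCode (coordCode b.unpair.1 i)| := by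
  rw [Subtype.dist_eq, Real.dist_eq, ballCenter, ballCenter, coe_ratPoint, coe_ratPoint]

/-- For the maximum norm the condition splits into coordinates. The inequalities are arranged
without subtraction, since codes exist only for non-negative rationals. In dimension `0` the right
side would be vacuous. -/
theorem wellInside_iff (hn : 1 ≤ n) (a b : ℕ) : WellInside n a b ↔ ∀ i < n,
    ratCode (addCode (coordCode a.unpair.1 i) a.unpair.2) <
      ratCode (addCode (coordCode b.unpair.1 i) b.unpair.2) ∧
    ratCode (addCode (coordCode b.unpair.1 i) a.unpair.2) <
      ratCode (addCode (coordCode a.unpair.1 i) b.unpair.2) := by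
  simp only [ratCode_addCode]
  constructor
  · intro h i hi
    have h1 := (dist_le_pi_dist (ballCenter n a) (ballCenter n b) ⟨i, hi⟩)
    rw [dist_ballCenter_apply, abs_le] at h1
    simp only [WellInside, ballRadius] at h
    dsimp only at h1
    constructor <;> linarith [h1.1, h1.2]
  · intro h
    -- Adding the two inequalities of one coordinate shows that `b` has the larger radius, the
    -- positivity needed for the coordinatewise criterion.
    have h0 := h 0 hn
    rw [WellInside, ← lt_sub_iff_add_lt, dist_pi_lt_iff (by
      simp only [ballRadius]
      linarith [h0.1, h0.2])]
    intro i
    rw [dist_ballCenter_apply, abs_lt]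
    simp only [ballRadius]
    constructor <;> linarith [(h i i.2).1, (h i i.2).2]

theorem touches_iff (a b : ℕ) : Touches n a b ↔ ∀ i < n,
    ¬ ratCode (addCode (coordCode b.unpair.1 i) (addCode a.unpair.2 b.unpair.2)) <
      ratCode (coordCode a.unpair.1 i) ∧
    ¬ ratCode (addCode (coordCode a.unpair.1 i) (addCode a.unpair.2 b.unpair.2)) <
      ratCode (coordCode b.unpair.1 i) := by
  simp only [ratCode_addCode, not_lt]
  rw [Touches, dist_pi_le_iff (add_nonneg (ballRadius_nonneg _) (ballRadius_nonneg _))]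
  simp only [dist_ballCenter_apply, abs_le, ballRadius]
  constructor
  · intro h i hi
    constructor <;> linarith [(h ⟨i, hi⟩).1, (h ⟨i, hi⟩).2]
  · intro h i
    constructor <;> linarith [(h i i.2).1, (h i i.2).2]

theorem primrecRel_wellInside (hn : 1 ≤ n) : PrimrecRel (WellInside n) := by
  have ca : Primrec fun x : (ℕ × ℕ) × ℕ => coordCode x.1.1.unpair.1 x.2 :=
    primrec_coordCode.comp (primrec_fst_unpair (Primrec.fst.comp Primrec.fst)) Primrec.snd
  have cb : Primrec fun x : (ℕ × ℕ) × ℕ => coordCode x.1.2.unpair.1 x.2 :=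
    primrec_coordCode.comp (primrec_fst_unpair (Primrec.snd.comp Primrec.fst)) Primrec.snd
  have ra : Primrec fun x : (ℕ × ℕ) × ℕ => x.1.1.unpair.2 :=
    primrec_snd_unpair (Primrec.fst.comp Primrec.fst)
  have rb : Primrec fun x : (ℕ × ℕ) × ℕ => x.1.2.unpair.2 :=
    primrec_snd_unpair (Primrec.snd.comp Primrec.fst)
  refine PrimrecPred.of_eq (primrecPred_forall_lt (Primrec.const n) (PrimrecPred.and
    (primrecPred_ratCode_lt (primrec_addCode.comp ca ra) (primrec_addCode.comp cb rb))
    (primrecPred_ratCode_lt (primrec_addCode.comp cb ra) (primrec_addCode.comp ca rb))))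
    fun x => (wellInside_iff hn x.1 x.2).symm

theorem primrecRel_touches (n : ℕ) : PrimrecRel (Touches n) := by
  have ca : Primrec fun x : (ℕ × ℕ) × ℕ => coordCode x.1.1.unpair.1 x.2 :=
    primrec_coordCode.comp (primrec_fst_unpair (Primrec.fst.comp Primrec.fst)) Primrec.snd
  have cb : Primrec fun x : (ℕ × ℕ) × ℕ => coordCode x.1.2.unpair.1 x.2 :=
    primrec_coordCode.comp (primrec_fst_unpair (Primrec.snd.comp Primrec.fst)) Primrec.snd
  have r : Primrec fun x : (ℕ × ℕ) × ℕ => addCode x.1.1.unpair.2 x.1.2.unpair.2 :=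
    primrec_addCode.comp (primrec_snd_unpair (Primrec.fst.comp Primrec.fst))
      (primrec_snd_unpair (Primrec.snd.comp Primrec.fst))
  refine PrimrecPred.of_eq (primrecPred_forall_lt (Primrec.const n) (PrimrecPred.and
    (primrecPred_ratCode_lt (primrec_addCode.comp cb r) ca).not
    (primrecPred_ratCode_lt (primrec_addCode.comp ca r) cb).not))
    fun x => (touches_iff x.1 x.2).symm

/-- The code of the ball around the point with the coordinates `l / D`, with radius `2 / D`. -/
def latticeBall (D : ℕ) (l : List ℕ) : ℕ :=
  Nat.pair (Encodable.encode (l.map fun d => Nat.pair d (D - 1))) (Nat.pair 2 (D - 1))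

theorem primrec_latticeBall : Primrec₂ latticeBall := by
  have hD : Primrec fun x : ℕ × List ℕ => x.1 - 1 := Primrec.pred.comp Primrec.fst
  exact Primrec₂.natPair.comp
    (Primrec.encode.comp (Primrec.list_map Primrec.snd
      (Primrec₂.natPair.comp Primrec.snd (hD.comp Primrec.fst))))
    (Primrec₂.natPair.comp (Primrec.const 2) hD)

theorem ratCode_pair_sub_one {D : ℕ} (hD : 0 < D) (d : ℕ) :
    ratCode (Nat.pair d (D - 1)) = d / D := by
  have : ((D - 1 : ℕ) : ℝ) + 1 = D := by exact_mod_cast Nat.sub_add_cancel hD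
  rw [ratCode, Nat.unpair_pair, this]

theorem ballRadius_latticeBall {D : ℕ} (hD : 0 < D) (l : List ℕ) :
    ballRadius (latticeBall D l) = 2 / D := by
  rw [ballRadius, latticeBall, Nat.unpair_pair, ratCode_pair_sub_one hD]
  norm_num

theorem coe_ballCenter_latticeBall {D : ℕ} (hD : 0 < D) (l : List ℕ) (i : Fin n)
    (hl : l.getD i 0 ≤ D) : (ballCenter n (latticeBall D l) i : ℝ) = (l.getD i 0 : ℝ) / D := by
  have h : ratCode ((l.map fun d => Nat.pair d (D - 1)).getD i 0) = (l.getD i 0 : ℝ) / D := by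
    rw [List.getD_eq_getElem?_getD, List.getD_eq_getElem?_getD, List.getElem?_map]
    cases l[(i : ℕ)]?
    · simp [ratCode]
    · simpa using ratCode_pair_sub_one hD _
  rw [ballCenter, coe_ratPoint, coordCode, ratCode_clipCode, latticeBall, Nat.unpair_pair,
    Denumerable.ofNat_encode, h, min_eq_right]
  rw [div_le_one (by positivity)]
  exact_mod_cast hl

/-- A code of the empty ball. -/
def emptyBall : ℕ := Nat.pair 0 (Nat.pair 0 0)

theorem ratBall_emptyBall (n : ℕ) : ratBall n emptyBall = ∅ := by
  simp [ratBall, ratCode, emptyBall]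

end Balls

/-! ## Finite grids -/

/-- All words of length `n` with entries below `M`. -/
def grid (M : ℕ) : ℕ → List (List ℕ)
  | 0 => [[]]
  | n + 1 => (grid M n).flatMap fun l => (List.range M).map fun d => d :: l

theorem mem_grid {M n : ℕ} {l : List ℕ} : l ∈ grid M n ↔ l.length = n ∧ ∀ d ∈ l, d < M := by
  induction n generalizing l with
  | zero => simp +contextual [grid, List.length_eq_zero_iff]
  | succ n ih =>
    cases l with
    | nil => simp [grid]
    | cons d l =>
      simp only [grid, List.mem_flatMap, ih, List.mem_map, List.mem_range, List.cons.injEq,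
        List.length_cons, List.mem_cons, forall_eq_or_imp]
      constructor
      · rintro ⟨_, ⟨h1, h2⟩, _, h3, rfl, rfl⟩
        exact ⟨by omega, h3, h2⟩
      · rintro ⟨h1, h2, h3⟩
        exact ⟨l, ⟨by omega, h3⟩, d, h2, rfl, rfl⟩

theorem primrec_grid (n : ℕ) : Primrec fun M => grid M n := by
  induction n with
  | zero => exact Primrec.const _
  | succ n ih =>
    exact Primrec.list_flatMap ih (Primrec.list_map (Primrec.list_range.comp Primrec.fst)
      (Primrec.list_cons.comp Primrec.snd (Primrec.snd.comp Primrec.fst)))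

/-- All binary words of length `k`. -/
def binaryWords : ℕ → List (List Bool)
  | 0 => [[]]
  | k + 1 => (binaryWords k).flatMap fun w => [w ++ [false], w ++ [true]]

theorem mem_binaryWords {k : ℕ} {w : List Bool} : w ∈ binaryWords k ↔ w.length = k := by
  induction k generalizing w with
  | zero => simp [binaryWords]
  | succ k ih =>
    simp only [binaryWords, List.mem_flatMap, ih, List.mem_cons, List.not_mem_nil, or_false]
    constructor
    · rintro ⟨v, hv, rfl | rfl⟩ <;> simp [hv]
    · intro hw
      have hne : w ≠ [] := by
        rintro rfl
        simp at hw
      refine ⟨w.dropLast, by simp [hw], ?_⟩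
      have h := List.dropLast_append_getLast hne
      cases hb : w.getLast hne <;> rw [hb] at h
      · exact Or.inl h.symm
      · exact Or.inr h.symm

theorem primrec_binaryWords : Primrec binaryWords := by
  have hs : ∀ b : Bool, Primrec fun x : (ℕ × ℕ × List (List Bool)) × List Bool => x.2 ++ [b] :=
    fun b => Primrec.list_concat.comp Primrec.snd (Primrec.const b)
  refine (Primrec.nat_rec' (f := fun k : ℕ => k) (g := fun _ => [[]])
    (h := fun _ x => x.2.flatMap fun w : List Bool => [w ++ [false], w ++ [true]]) Primrec.id
    (Primrec.const _) (Primrec.list_flatMap (Primrec.snd.comp Primrec.snd)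
      (Primrec.list_cons.comp (hs false)
        (Primrec.list_cons.comp (hs true) (Primrec.const []))))).of_eq fun k => ?_
  induction k with
  | zero => rfl
  | succ k ih => simp only [ih, binaryWords]

/-! ## Connectedness components from chains of finite approximations -/

section Approximation

open Filter Topology Metric

variable {X : Type*} [MetricSpace X] {c : ℕ → X} {r : ℕ → ℝ} {I alive S : ℕ → Set ℕ} {A : Set X}

/-- `I k` are the cells of level `k`, `alive k` those not yet excluded, and `S k` the selected ones.
`hA` and `hA'` say that the alive cells approximate `A` from outside, `hclosed` that selected cells
are isolated from other alive ones, and `hconn` that they form one chain-connected block. -/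
theorem isConnectednessComponent_of_approximation [CompactSpace X] (hr : Tendsto r atTop (𝓝 0))
    (hI : ∀ k, (I k).Finite) (hcov : ∀ k y, ∃ b ∈ I k, dist y (c b) < r k)
    (halive : ∀ k, alive k ⊆ I k)
    (hA : ∀ k, ∀ y ∈ A, ∀ b ∈ I k, dist y (c b) ≤ r k → b ∈ alive k)
    (hA' : ∀ y ∉ A, ∃ k, ∀ b ∈ alive k, r k < dist y (c b))
    (hsub : ∀ k, S k ⊆ alive k) (hne : ∀ k, (S k).Nonempty)
    (hclosed : ∀ k, ∀ b ∈ S k, ∀ b' ∈ alive k, dist (c b) (c b') ≤ r k + r k → b' ∈ S k)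
    (hlink : ∀ k, ∀ b ∈ S (k + 1), ∃ b' ∈ S k, dist (c b) (c b') + r (k + 1) ≤ r k)
    (hconn : ∀ k, ∀ s : Set ℕ, (∃ a ∈ S k, a ∈ s) → (∃ b ∈ S k, b ∉ s) →
      ∃ a ∈ S k, a ∈ s ∧ ∃ b ∈ S k, b ∉ s ∧ dist (c a) (c b) ≤ r k + r k) :
    ((⋃ k, ⋃ b ∈ I k \ S k, ball (c b) (r k))ᶜ).Nonempty ∧
      IsConnectednessComponent (⋃ k, ⋃ b ∈ I k \ S k, ball (c b) (r k))ᶜ A := by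
  set C := (⋃ k, ⋃ b ∈ I k \ S k, ball (c b) (r k))ᶜ with hC
  have hpos : ∀ k, 0 < r k := fun k => by
    obtain ⟨b, -, hb⟩ := hcov k (c 0)
    exact dist_nonneg.trans_lt hb
  have hSfin : ∀ k, (S k).Finite := fun k => (hI k).subset ((hsub k).trans (halive k))
  let E : ℕ → Set X := fun k => ⋃ b ∈ S k, closedBall (c b) (r k)
  have mem_E : ∀ {k y}, y ∈ E k ↔ ∃ b ∈ S k, dist y (c b) ≤ r k := by
    intro k y
    simp [E]
  have hEclosed : ∀ k, IsClosed (E k) := fun k =>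
    (hSfin k).isClosed_biUnion fun b _ => isClosed_closedBall
  have hEne : ∀ k, (E k).Nonempty := fun k => by
    obtain ⟨b, hb⟩ := hne k
    exact ⟨c b, mem_E.2 ⟨b, hb, by simpa using (hpos k).le⟩⟩
  have hEsucc : ∀ k, E (k + 1) ⊆ E k := by
    intro k y hy
    obtain ⟨b, hb, hyb⟩ := mem_E.1 hy
    obtain ⟨b', hb', h⟩ := hlink k b hb
    exact mem_E.2 ⟨b', hb', by linarith [dist_triangle y (c b) (c b')]⟩
  have hEanti : Antitone E := antitone_nat_of_succ_le hEsucc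
  have hEA : (⋂ k, E k) ⊆ A := by
    intro y hy
    by_contra hyA
    obtain ⟨k, hk⟩ := hA' y hyA
    obtain ⟨b, hb, hyb⟩ := mem_E.1 (Set.mem_iInter.1 hy k)
    exact absurd (hk b (hsub k hb)) hyb.not_gt
  have hCE : C = ⋂ k, E k := by
    -- A point in no unselected open cell lies in a selected one, since the open cells cover.
    -- Conversely, a point of every `E k` is in `A`, so any cell around it is alive and touches a
    -- selected cell, hence is selected.
    refine Set.Subset.antisymm (fun y hy => Set.mem_iInter.2 fun k => ?_) fun y hy => ?_
    · obtain ⟨b, hb, hyb⟩ := hcov k y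
      refine mem_E.2 ⟨b, ?_, hyb.le⟩
      by_contra hbS
      exact hy (Set.mem_iUnion.2 ⟨k, Set.mem_biUnion (x := b) ⟨hb, hbS⟩ hyb⟩)
    · intro hy'
      simp only [Set.mem_iUnion, mem_ball] at hy'
      obtain ⟨k, b, hb, hyb⟩ := hy'
      obtain ⟨b', hb', hyb'⟩ := mem_E.1 (Set.mem_iInter.1 hy k)
      exact hb.2 (hclosed k b' hb' b (hA k y (hEA hy) b hb.1 hyb.le)
        (by linarith [dist_triangle_left (c b') (c b) y]))
  have hCne : C.Nonempty := by
    rw [hCE]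
    exact IsCompact.nonempty_iInter_of_sequence_nonempty_isCompact_isClosed E hEsucc hEne
      (hEclosed 0).isCompact hEclosed
  have hCclosed : IsClosed C := by
    rw [hCE]
    exact isClosed_iInter hEclosed
  have hCsub : ∀ k, C ⊆ E k := fun k => hCE ▸ Set.iInter_subset _ k
  refine ⟨hCne, ⟨hCE ▸ hEA, ?_⟩, ?_⟩
  · rw [isPreconnected_closed_iff]
    intro t t' ht ht' htt' hCt hCt'
    by_contra hdis
    have hd : Disjoint (C ∩ t) (C ∩ t') := by
      rw [Set.disjoint_left]
      exact fun y hy hy' => hdis ⟨y, hy.1, hy.2, hy'.2⟩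
    -- A splitting of `C` leaves a gap of width `δ`. At a level with `E k` within `δ / 2` of the two
    -- parts and `r k < δ / 4`, touching cells have centers less than `δ / 2` apart and cannot
    -- bridge the gap, against `hconn`.
    obtain ⟨δ, hδ, hdδ⟩ := hd.exists_thickenings (hCclosed.inter ht).isCompact
      (hCclosed.inter ht')
    have hU : ∃ k, E k ⊆ thickening (δ / 2) (C ∩ t) ∪ thickening (δ / 2) (C ∩ t') := by
      refine exists_subset_nhds_of_isCompact' (directed_of_isDirected_le hEanti)
        (fun k => (hEclosed k).isCompact) hEclosed fun y hy => ?_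
      refine (isOpen_thickening.union isOpen_thickening).mem_nhds ?_
      rw [← hCE] at hy
      rcases htt' hy with h | h
      · exact Or.inl (self_subset_thickening (half_pos hδ) _ ⟨hy, h⟩)
      · exact Or.inr (self_subset_thickening (half_pos hδ) _ ⟨hy, h⟩)
    obtain ⟨k₀, hk₀⟩ := hU
    obtain ⟨k, hk, hkr⟩ : ∃ k, k₀ ≤ k ∧ r k < δ / 4 :=
      ((eventually_ge_atTop k₀).and (hr.eventually_lt_const (by linarith))).exists
    have hcE : ∀ b ∈ S k, c b ∈ E k := fun b hb =>
      mem_E.2 ⟨b, hb, by simpa using (hpos k).le⟩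
    have near : ∀ F : Set X, F ⊆ C → F.Nonempty → ∃ b ∈ S k, c b ∈ thickening (δ / 2) F := by
      rintro F hF ⟨y, hy⟩
      obtain ⟨b, hb, hyb⟩ := mem_E.1 (hCsub k (hF hy))
      exact ⟨b, hb, mem_thickening_iff.2 ⟨y, hy, by rw [dist_comm]; linarith⟩⟩
    obtain ⟨a, ha, has⟩ := near (C ∩ t) Set.inter_subset_left hCt
    obtain ⟨b, hb, hbs⟩ := near (C ∩ t') Set.inter_subset_left hCt'
    have hmono : ∀ F : Set X, thickening (δ / 2) F ⊆ thickening δ F := fun F =>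
      thickening_mono (by linarith) F
    obtain ⟨a', ha', has', b', hb', hbs', hab⟩ := hconn k {b | c b ∈ thickening (δ / 2) (C ∩ t)}
      ⟨a, ha, has⟩ ⟨b, hb, fun h => Set.disjoint_left.1 hdδ (hmono _ h) (hmono _ hbs)⟩
    have hb2 : c b' ∈ thickening (δ / 2) (C ∩ t') :=
      (hk₀ (hEanti hk (hcE b' hb'))).resolve_left hbs'
    refine Set.disjoint_left.1 hdδ (hmono _ has') ?_
    obtain ⟨z, hz, hbz⟩ := mem_thickening_iff.1 hb2
    exact mem_thickening_iff.2 ⟨z, hz, by linarith [dist_triangle (c a') (c b') z]⟩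
  · rintro D ⟨hDA, hD⟩ hCD y hy
    rw [hCE, Set.mem_iInter]
    intro k
    -- The selected cells and the other alive cells form two closed sets covering `D`. They are
    -- disjoint by `hclosed`, so the connected set `D`, which meets the first through `C`, stays
    -- inside it.
    have hclosed' : IsClosed (⋃ b ∈ alive k \ S k, closedBall (c b) (r k)) :=
      ((hI k).subset (Set.sdiff_subset.trans (halive k))).isClosed_biUnion
        fun b _ => isClosed_closedBall
    by_contra hyE
    have hcover : D ⊆ E k ∪ ⋃ b ∈ alive k \ S k, closedBall (c b) (r k) := by
      intro z hz
      obtain ⟨b, hb, hzb⟩ := hcov k z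
      have hba := hA k z (hDA hz) b hb hzb.le
      by_cases hbS : b ∈ S k
      · exact Or.inl (mem_E.2 ⟨b, hbS, hzb.le⟩)
      · exact Or.inr (Set.mem_biUnion (x := b) ⟨hba, hbS⟩ hzb.le)
    obtain ⟨x, hx⟩ := hCne
    obtain ⟨z, -, hz, hz'⟩ := isPreconnected_closed_iff.1 hD _ _ (hEclosed k) hclosed' hcover
      ⟨x, hCD hx, hCsub k hx⟩ ⟨y, hy, (hcover hy).resolve_left hyE⟩
    obtain ⟨b, hb, hzb⟩ := mem_E.1 hz
    simp only [Set.mem_iUnion, mem_closedBall] at hz'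
    obtain ⟨b', hb', hzb'⟩ := hz'
    exact hb'.2 (hclosed k b hb b' hb'.1 (by linarith [dist_triangle_left (c b) (c b') z]))

/-- The cells of a level which are linked with the point `a` by a chain of touching cells. -/
def chainComponent (c : ℕ → X) (r : ℕ → ℝ) (alive : ℕ → Set ℕ) (a : X) (k : ℕ) : Set ℕ :=
  {b | ∃ b₀ ∈ alive k, dist a (c b₀) ≤ r k ∧ Relation.ReflTransGen
    (fun b b' => b' ∈ alive k ∧ dist (c b) (c b') ≤ r k + r k) b₀ b}

variable {a : X} {k : ℕ}

theorem chainComponent_subset : chainComponent c r alive a k ⊆ alive k := by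
  rintro b ⟨b₀, hb₀, -, h⟩
  cases h with
  | refl => exact hb₀
  | tail _ h => exact h.1

theorem mem_chainComponent_of_dist_le {b b' : ℕ} (hb : b ∈ chainComponent c r alive a k)
    (hb' : b' ∈ alive k) (h : dist (c b) (c b') ≤ r k + r k) :
    b' ∈ chainComponent c r alive a k := by
  obtain ⟨b₀, hb₀, h0, hc⟩ := hb
  exact ⟨b₀, hb₀, h0, hc.tail ⟨hb', h⟩⟩

/-- Touching is symmetric, so membership in `s` is constant along chains in both directions; the
initial cells of any two chains both contain `a` and therefore touch. -/
theorem chainComponent_subset_of_closed {s : Set ℕ}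
    (hs : ∃ b ∈ chainComponent c r alive a k, b ∈ s)
    (hcl : ∀ b ∈ chainComponent c r alive a k, b ∈ s → ∀ b' ∈ chainComponent c r alive a k,
      dist (c b) (c b') ≤ r k + r k → b' ∈ s) : chainComponent c r alive a k ⊆ s := by
  have fwd : ∀ b₀ ∈ chainComponent c r alive a k, ∀ b, Relation.ReflTransGen
      (fun b b' => b' ∈ alive k ∧ dist (c b) (c b') ≤ r k + r k) b₀ b →
      b ∈ chainComponent c r alive a k ∧ (b₀ ∈ s ↔ b ∈ s) := by
    intro b₀ hb₀ b h
    induction h with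
    | refl => exact ⟨hb₀, Iff.rfl⟩
    | tail _ h ih =>
      have h2 := mem_chainComponent_of_dist_le ih.1 h.1 h.2
      refine ⟨h2, ih.2.trans ⟨fun hb => hcl _ ih.1 hb _ h2 h.2, fun hb => ?_⟩⟩
      exact hcl _ h2 hb _ ih.1 (by rw [dist_comm]; exact h.2)
  obtain ⟨b, ⟨b₀, hb₀, h0, hc⟩, hbs⟩ := hs
  rintro b' ⟨b₁, hb₁, h1, hc'⟩
  have m0 : b₀ ∈ chainComponent c r alive a k := ⟨b₀, hb₀, h0, .refl⟩
  have m1 : b₁ ∈ chainComponent c r alive a k := ⟨b₁, hb₁, h1, .refl⟩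
  refine (fwd b₁ m1 b' hc').2.1 (hcl b₀ m0 ((fwd b₀ m0 b hc).2.2 hbs) b₁ m1 ?_)
  linarith [dist_triangle_left (c b₀) (c b₁) a]

/-- A chain of level `k + 1` is lifted to parents of its cells. Parents of touching cells touch,
since each parent adds less than `r k - r (k + 1)` to the distance of the centers. -/
theorem mem_chainComponent_of_succ
    (hparent : ∀ b ∈ alive (k + 1), ∃ b' ∈ I k, dist (c b) (c b') + r (k + 1) < r k)
    (halive : ∀ b ∈ alive (k + 1), ∀ b' ∈ I k, dist (c b) (c b') + r (k + 1) < r k → b' ∈ alive k)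
    {b b' : ℕ} (hb : b ∈ chainComponent c r alive a (k + 1)) (hb' : b' ∈ I k)
    (h : dist (c b) (c b') + r (k + 1) < r k) : b' ∈ chainComponent c r alive a k := by
  obtain ⟨b₀, hb₀, h0, hc⟩ := hb
  induction hc generalizing b' with
  | refl =>
    exact ⟨b', halive _ hb₀ _ hb' h, by linarith [dist_triangle a (c b₀) (c b')], .refl⟩
  | @tail b₁ b₂ hc h12 ih =>
    have h1 : b₁ ∈ alive (k + 1) := chainComponent_subset (a := a) ⟨b₀, hb₀, h0, hc⟩
    obtain ⟨b₁', hb₁', h1'⟩ := hparent b₁ h1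
    refine mem_chainComponent_of_dist_le (ih hb₁' h1') (halive _ h12.1 _ hb' h) ?_
    have := dist_triangle4 (c b₁') (c b₁) (c b₂) (c b')
    rw [dist_comm (c b₁') (c b₁)] at this
    linarith [h12.2]

end Approximation

/-! ## Binary trees given by a primitive recursive set of forbidden pairs of words -/

section ForbiddenTree

/-- The binary tree of all words without prefixes that are forbidden relative to `p`. -/
def forbiddenTree (R : List ℕ → List Bool → Prop) (p : Baire) : BinaryTree where
  carrier := {w | ∀ i ≤ w.length, ¬ R (initSeg p i) (w.take i)}
  prefix_closed := by
    rintro u v ⟨t, rfl⟩ h i hi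
    have := h i (hi.trans (by simp))
    rwa [List.take_append_of_le_length hi] at this

theorem initSeg_mem_forbiddenTree {R : List ℕ → List Bool → Prop} {p : Baire} {x : ℕ → Bool} :
    (∀ k, initSeg x k ∈ (forbiddenTree R p).carrier) ↔
      ∀ i, ¬ R (initSeg p i) (initSeg x i) := by
  constructor
  · intro h i
    have := h i i (by simp)
    rwa [take_initSeg x le_rfl] at this
  · intro h k i hi
    rw [length_initSeg] at hi
    rw [take_initSeg x hi]
    exact h i

theorem infinite_of_forall_initSeg_mem {T : BinaryTree} {x : ℕ → Bool}
    (h : ∀ k, initSeg x k ∈ T.carrier) : T.carrier.Infinite := by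
  refine Set.infinite_of_injective_forall_mem (f := initSeg x) (fun j k hjk => ?_) h
  simpa using congrArg List.length hjk

open Classical in
/-- The characteristic function of a forbidden tree, computed from prefixes of the parameter. -/
noncomputable def forbiddenTreeEntry (R : List ℕ → List Bool → Prop) (u : List ℕ) (m : ℕ) :
    Option ℕ :=
  Option.casesOn (Encodable.decode₂ (List Bool) m) (some 0) fun w =>
    if w.length ≤ u.length then
      some (if ∀ i < w.length + 1, ¬ R (u.take i) (w.take i) then 1 else 0)
    else none

theorem primrec_forbiddenTreeEntry {R : List ℕ → List Bool → Prop} (hR : PrimrecRel R) :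
    Primrec₂ (forbiddenTreeEntry R) := by
  classical
  have hw : Primrec fun x : (List ℕ × ℕ) × List Bool => x.2.length :=
    Primrec.list_length.comp Primrec.snd
  have hu : Primrec fun x : (List ℕ × ℕ) × List Bool => x.1.1 :=
    Primrec.fst.comp Primrec.fst
  refine Primrec.option_casesOn (Primrec.decode₂.comp Primrec.snd) (Primrec.const _)
    (Primrec.ite (Primrec.nat_le.comp hw (Primrec.list_length.comp hu))
      (Primrec.option_some.comp (Primrec.ite ?_ (Primrec.const 1) (Primrec.const 0)))
      (Primrec.const _))
  refine primrecPred_forall_lt (Primrec.succ.comp hw) (PrimrecPred.not ?_)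
  exact hR.comp (Primrec.list_take.comp Primrec.snd (hu.comp Primrec.fst))
    (Primrec.list_take.comp Primrec.snd (Primrec.snd.comp Primrec.fst))

/-- Membership of `w` depends only on the first `w.length` symbols of `p`, so the entry is output
once these are read. Numbers that code no word receive the value `0` at once. -/
theorem exists_name_forbiddenTree (R : List ℕ → List Bool → Prop) (p : Baire) :
    ∃ t ∈ pointwise (forbiddenTreeEntry R) p, RepresentedSpace.Names t (forbiddenTree R p) := by
  classical
  refine ⟨fun m => if ∃ w ∈ (forbiddenTree R p).carrier, Encodable.encode w = m then 1 else 0,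
    ?_, fun m => ⟨fun h => if_pos h, fun h => if_neg h⟩⟩
  have key : ∀ m (w : List Bool), Encodable.decode₂ (List Bool) m = some w → ∀ k, w.length ≤ k →
      ((∀ i < w.length + 1, ¬ R ((initSeg p k).take i) (w.take i)) ↔
        ∃ w ∈ (forbiddenTree R p).carrier, Encodable.encode w = m) := by
    intro m w hm k hk
    have : (∀ i < w.length + 1, ¬ R ((initSeg p k).take i) (w.take i)) ↔
        w ∈ (forbiddenTree R p).carrier := by
      refine forall_congr' fun i => ?_
      rw [Nat.lt_succ_iff]
      refine imp_congr_right fun hi => ?_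
      rw [take_initSeg p (hi.trans hk)]
    rw [this]
    constructor
    · intro h
      exact ⟨w, h, Encodable.mem_decode₂.1 hm⟩
    · rintro ⟨v, hv, rfl⟩
      rw [Encodable.encodek₂] at hm
      cases hm
      exact hv
  refine mem_pointwise (fun m => ?_) fun m k a h => ?_
  · cases hm : Encodable.decode₂ (List Bool) m with
    | none =>
      refine ⟨0, ?_⟩
      simp only [forbiddenTreeEntry, hm]
      rw [if_neg]
      rintro ⟨w, -, rfl⟩
      simp at hm
    | some w =>
      refine ⟨w.length, ?_⟩
      simp only [forbiddenTreeEntry, hm]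
      rw [if_pos (by simp)]
      simp only [key m w hm _ le_rfl]
  · cases hm : Encodable.decode₂ (List Bool) m with
    | none =>
      simp only [forbiddenTreeEntry, hm, Option.some.injEq] at h
      subst h
      rw [if_neg]
      rintro ⟨w, -, rfl⟩
      simp at hm
    | some w =>
      simp only [forbiddenTreeEntry, hm, length_initSeg] at h
      split_ifs at h with h1 h2
      · rw [if_pos ((key m w hm k h1).1 h2)]
        simpa using h.symm
      · rw [if_neg fun h3 => h2 ((key m w hm k h1).2 h3)]
        simpa using h.symm

end ForbiddenTree

/-! ## The cells of the cube -/

section Cells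

variable {n : ℕ}

/-- The codes of the cells of level `k`: balls of radius `2 / 2 ^ k` around the points of a grid. -/
def cells (n k : ℕ) : List ℕ := (grid (2 ^ k + 1) n).map (latticeBall (2 ^ k))

theorem primrec_cells (n : ℕ) : Primrec (cells n) := by
  have h2 : Primrec fun k : ℕ => 2 ^ k := primrec_pow.comp (Primrec.const 2) Primrec.id
  exact Primrec.list_map ((primrec_grid n).comp (Primrec.succ.comp h2))
    (primrec_latticeBall.comp (h2.comp Primrec.fst) Primrec.snd)

theorem ballRadius_of_mem_cells {k b : ℕ} (hb : b ∈ cells n k) : ballRadius b = 2 / 2 ^ k := by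
  obtain ⟨l, -, rfl⟩ := List.mem_map.1 hb
  rw [ballRadius_latticeBall (by positivity)]
  push_cast
  rfl

/-- Coordinates are rounded down to multiples of `1 / 2 ^ k`. The bound is half the cell radius; the
spare half places every cell of level `k + 1` inside a cell of level `k`. -/
theorem exists_mem_cells (k : ℕ) (y : Cube n) :
    ∃ b ∈ cells n k, dist y (ballCenter n b) < 1 / 2 ^ k := by
  have hD : (0 : ℝ) < 2 ^ k := by positivity
  let d : Fin n → ℕ := fun i => ⌊(y i : ℝ) * 2 ^ k⌋₊
  have hd : ∀ i, (d i : ℝ) ≤ y i * 2 ^ k := fun i =>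
    Nat.floor_le (mul_nonneg (y i).2.1 hD.le)
  have hd' : ∀ i, (y i : ℝ) * 2 ^ k < d i + 1 := fun i => Nat.lt_floor_add_one _
  have hle : ∀ i, d i ≤ 2 ^ k := by
    intro i
    have : (d i : ℝ) ≤ 2 ^ k := (hd i).trans (mul_le_of_le_one_left hD.le (y i).2.2)
    exact_mod_cast this
  refine ⟨latticeBall (2 ^ k) (List.ofFn d), List.mem_map.2 ⟨_, mem_grid.2 ⟨by simp, ?_⟩, rfl⟩, ?_⟩
  · intro e he
    obtain ⟨i, rfl⟩ := (List.mem_ofFn' _ _).1 he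
    exact Nat.lt_succ_of_le (hle i)
  · rw [dist_pi_lt_iff (by positivity)]
    intro i
    have hi : (List.ofFn d).getD i 0 = d i := by simp
    rw [Subtype.dist_eq, Real.dist_eq, coe_ballCenter_latticeBall (by positivity) _ _ (hi ▸ hle i),
      hi]
    push_cast
    rw [show (y i : ℝ) - d i / 2 ^ k = (y i * 2 ^ k - d i) / 2 ^ k by field_simp,
      abs_of_nonneg (div_nonneg (sub_nonneg.2 (hd i)) hD.le)]
    gcongr
    linarith [hd' i]

/-- The cell `b` is known to be disjoint from the complement of the balls in `u`. -/
def Excluded (n : ℕ) (u : List ℕ) (b : ℕ) : Prop := ∃ p ∈ u, WellInside n b p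

theorem primrecRel_excluded (hn : 1 ≤ n) : PrimrecRel (Excluded n) :=
  primrecPred_exists_mem Primrec.fst
    ((primrecRel_wellInside hn).comp (Primrec.snd.comp Primrec.fst) Primrec.snd)

end Cells

/-! ## The conditions on a code of a connectedness component -/

section Conditions

variable (n : ℕ) (u : List ℕ) (w : List Bool) (k : ℕ)

/-- The entry of `w` which tells whether the cell `b` of level `k` is selected, if known. -/
def selected (b : ℕ) : Option Bool := w[Nat.pair k b]?

/-- No cell of level `k` is selected. -/
def NoneSelected : Prop := ∀ b ∈ cells n k, selected w k b = some false

/-- An excluded cell of level `k` is selected. -/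
def ExcludedSelected : Prop :=
  ∃ b ∈ cells n k, selected w k b = some true ∧ Excluded n (u.take k) b

/-- The selected cells of level `k` are not closed under touching. -/
def NotTouchClosed : Prop :=
  ∃ b ∈ cells n k, ∃ b' ∈ cells n k, selected w k b = some true ∧ selected w k b' = some false ∧
    Touches n b b' ∧ ¬ Excluded n (u.take k) b'

/-- A selected cell of level `k + 1` lies inside of a cell of level `k` which is not selected. -/
def NotLinked : Prop :=
  ∃ b ∈ cells n (k + 1), ∃ b' ∈ cells n k, selected w (k + 1) b = some true ∧
    selected w k b' = some false ∧ WellInside n b b'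

/-- The list coded by `s` separates the selected cells of level `k`. -/
def SeparatedBy (s : ℕ) : Prop :=
  (∃ b ∈ cells n k, selected w k b = some true ∧ b ∈ Denumerable.ofNat (List ℕ) s) ∧
  (∃ b ∈ cells n k, selected w k b = some true ∧ b ∉ Denumerable.ofNat (List ℕ) s) ∧
  ∀ b ∈ cells n k, ∀ b' ∈ cells n k, b ∈ Denumerable.ofNat (List ℕ) s →
    b' ∉ Denumerable.ofNat (List ℕ) s → Touches n b b' →
      selected w k b = some false ∨ selected w k b' = some false

/-- The word `w` cannot be extended to a code of a connectedness component of the complement of the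
balls listed by a sequence which starts with `u`. -/
def Forbidden (n : ℕ) (u : List ℕ) (w : List Bool) : Prop :=
  ∃ k < w.length, NoneSelected n w k ∨ ExcludedSelected n u w k ∨ NotTouchClosed n u w k ∨
    NotLinked n w k ∨ ∃ s < w.length, SeparatedBy n w k s

variable {n}

theorem primrecPred_selected {α : Type*} [Primcodable α] {w : α → List Bool} {k b : α → ℕ}
    (c : Bool) (hw : Primrec w) (hk : Primrec k) (hb : Primrec b) :
    PrimrecPred fun x => selected (w x) (k x) (b x) = some c :=
  Primrec.eq.comp (Primrec.list_getElem?.comp hw (Primrec₂.natPair.comp hk hb))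
    (Primrec.const (some c))

theorem primrecPred_separatedBy (n : ℕ) :
    PrimrecPred fun x : (List Bool × ℕ) × ℕ => SeparatedBy n x.1.1 x.1.2 x.2 := by
  have hw : Primrec fun x : ((List Bool × ℕ) × ℕ) × ℕ => x.1.1.1 :=
    Primrec.fst.comp (Primrec.fst.comp Primrec.fst)
  have hk : Primrec fun x : ((List Bool × ℕ) × ℕ) × ℕ => x.1.1.2 :=
    Primrec.snd.comp (Primrec.fst.comp Primrec.fst)
  have hs : Primrec fun x : ((List Bool × ℕ) × ℕ) × ℕ => Denumerable.ofNat (List ℕ) x.1.2 :=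
    (Primrec.ofNat (List ℕ)).comp (Primrec.snd.comp Primrec.fst)
  have hc : Primrec fun x : (List Bool × ℕ) × ℕ => cells n x.1.2 :=
    (primrec_cells n).comp (Primrec.snd.comp Primrec.fst)
  have hsel := primrecPred_selected true hw hk Primrec.snd
  have hmem := primrecPred_mem hs Primrec.snd
  have h1 := primrecPred_exists_mem hc (p := fun x b => selected x.1.1 x.1.2 b = some true ∧
    b ∈ Denumerable.ofNat (List ℕ) x.2) (hsel.and hmem)
  have h2 := primrecPred_exists_mem hc (p := fun x b => selected x.1.1 x.1.2 b = some true ∧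
    b ∉ Denumerable.ofNat (List ℕ) x.2) (hsel.and hmem.not)
  have c1 : Primrec fun x : (((List Bool × ℕ) × ℕ) × ℕ) × ℕ => x.1.2 :=
    Primrec.snd.comp Primrec.fst
  have c2 : Primrec fun x : (((List Bool × ℕ) × ℕ) × ℕ) × ℕ => x.2 := Primrec.snd
  have f : Primrec fun x : (((List Bool × ℕ) × ℕ) × ℕ) × ℕ => x.1 := Primrec.fst
  have s1 : PrimrecPred fun x : (((List Bool × ℕ) × ℕ) × ℕ) × ℕ =>
      x.1.2 ∈ Denumerable.ofNat (List ℕ) x.1.1.2 := primrecPred_mem (hs.comp f) c1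
  have s2 : PrimrecPred fun x : (((List Bool × ℕ) × ℕ) × ℕ) × ℕ =>
      x.2 ∈ Denumerable.ofNat (List ℕ) x.1.1.2 := primrecPred_mem (hs.comp f) c2
  have t : PrimrecPred fun x : (((List Bool × ℕ) × ℕ) × ℕ) × ℕ => Touches n x.1.2 x.2 :=
    (primrecRel_touches n).comp c1 c2
  have e1 : PrimrecPred fun x : (((List Bool × ℕ) × ℕ) × ℕ) × ℕ =>
      selected x.1.1.1.1 x.1.1.1.2 x.1.2 = some false :=
    primrecPred_selected false (hw.comp f) (hk.comp f) c1
  have e2 : PrimrecPred fun x : (((List Bool × ℕ) × ℕ) × ℕ) × ℕ =>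
      selected x.1.1.1.1 x.1.1.1.2 x.2 = some false :=
    primrecPred_selected false (hw.comp f) (hk.comp f) c2
  have h3 : PrimrecPred fun x : (((List Bool × ℕ) × ℕ) × ℕ) × ℕ =>
      x.1.2 ∈ Denumerable.ofNat (List ℕ) x.1.1.2 → x.2 ∉ Denumerable.ofNat (List ℕ) x.1.1.2 →
        Touches n x.1.2 x.2 → selected x.1.1.1.1 x.1.1.1.2 x.1.2 = some false ∨
          selected x.1.1.1.1 x.1.1.1.2 x.2 = some false := by
    have h := s1.not.or (s2.or (t.not.or (e1.or e2)))
    refine h.of_eq fun x => ?_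
    rw [← or_iff_not_imp_left, ← imp_iff_not_or, ← imp_iff_not_or]
  have h4 := primrecPred_forall_mem (hc.comp (Primrec.fst (β := ℕ))) (p := fun x b' =>
      x.2 ∈ Denumerable.ofNat (List ℕ) x.1.2 → b' ∉ Denumerable.ofNat (List ℕ) x.1.2 →
        Touches n x.2 b' → selected x.1.1.1 x.1.1.2 x.2 = some false ∨
          selected x.1.1.1 x.1.1.2 b' = some false) h3
  have h5 := primrecPred_forall_mem hc (p := fun x b => ∀ b' ∈ cells n x.1.2,
      b ∈ Denumerable.ofNat (List ℕ) x.2 → b' ∉ Denumerable.ofNat (List ℕ) x.2 →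
        Touches n b b' → selected x.1.1 x.1.2 b = some false ∨
          selected x.1.1 x.1.2 b' = some false) h4
  exact h1.and (h2.and h5)

/-- All quantifiers range over finite lists of cells or below the length of `w`. Bounding the code
`s` of a separating list in this way loses nothing along a path, since longer prefixes reach every
code. -/
theorem primrecRel_forbidden (hn : 1 ≤ n) : PrimrecRel (Forbidden n) := by
  have hw : Primrec fun x : (List ℕ × List Bool) × ℕ => x.1.2 := Primrec.snd.comp Primrec.fst
  have hk : Primrec fun x : (List ℕ × List Bool) × ℕ => x.2 := Primrec.snd
  have hu : Primrec fun x : (List ℕ × List Bool) × ℕ => x.1.1.take x.2 :=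
    Primrec.list_take.comp hk (Primrec.fst.comp Primrec.fst)
  have hc : Primrec fun x : (List ℕ × List Bool) × ℕ => cells n x.2 := (primrec_cells n).comp hk
  have hc' : Primrec fun x : (List ℕ × List Bool) × ℕ => cells n (x.2 + 1) :=
    (primrec_cells n).comp (Primrec.succ.comp hk)
  have b1 : Primrec fun x : (((List ℕ × List Bool) × ℕ) × ℕ) × ℕ => x.1.2 :=
    Primrec.snd.comp Primrec.fst
  have hf : Primrec fun x : (((List ℕ × List Bool) × ℕ) × ℕ) × ℕ => x.1.1 :=
    Primrec.fst.comp Primrec.fst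
  refine primrecPred_exists_lt (Primrec.list_length.comp Primrec.snd) (PrimrecPred.or ?_
    (PrimrecPred.or ?_ (PrimrecPred.or ?_ (PrimrecPred.or ?_ ?_))))
  · exact primrecPred_forall_mem hc
      (primrecPred_selected false (hw.comp Primrec.fst) (hk.comp Primrec.fst) Primrec.snd)
  · exact primrecPred_exists_mem hc
      ((primrecPred_selected true (hw.comp Primrec.fst) (hk.comp Primrec.fst) Primrec.snd).and
        ((primrecRel_excluded hn).comp (hu.comp Primrec.fst) Primrec.snd))
  · exact primrecPred_exists_mem hc (primrecPred_exists_mem (hc.comp Primrec.fst)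
      ((primrecPred_selected true (hw.comp hf) (hk.comp hf) b1).and
        ((primrecPred_selected false (hw.comp hf) (hk.comp hf) Primrec.snd).and
          (((primrecRel_touches n).comp b1 Primrec.snd).and
            ((primrecRel_excluded hn).comp (hu.comp hf) Primrec.snd).not))))
  · exact primrecPred_exists_mem hc' (primrecPred_exists_mem (hc.comp Primrec.fst)
      ((primrecPred_selected true (hw.comp hf) (Primrec.succ.comp (hk.comp hf)) b1).and
        ((primrecPred_selected false (hw.comp hf) (hk.comp hf) Primrec.snd).and
          ((primrecRel_wellInside hn).comp b1 Primrec.snd))))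
  · have h : PrimrecPred fun x : ((List ℕ × List Bool) × ℕ) × ℕ =>
        SeparatedBy n x.1.1.2 x.1.2 x.2 :=
      (primrecPred_separatedBy n).comp (f := fun x : ((List ℕ × List Bool) × ℕ) × ℕ =>
        ((x.1.1.2, x.1.2), x.2))
        (Primrec.pair (Primrec.pair (hw.comp Primrec.fst) (hk.comp Primrec.fst)) Primrec.snd)
    exact primrecPred_exists_lt (Primrec.list_length.comp hw)
      (p := fun x s => SeparatedBy n x.1.2 x.2 s) h

end Conditions

/-! ## Connectedness components from infinite paths -/

section ComponentFromPath

open Filter Topology Metric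

variable {n : ℕ}

/-- The radius of the cells of level `k`. -/
noncomputable def cellRadius (k : ℕ) : ℝ := 2 / 2 ^ k

theorem cellRadius_eq_add (k : ℕ) : cellRadius k = 1 / 2 ^ k + cellRadius (k + 1) := by
  simp only [cellRadius]
  field_simp
  ring

theorem tendsto_cellRadius : Tendsto cellRadius atTop (𝓝 0) := by
  have h := (tendsto_pow_atTop_nhds_zero_of_lt_one (r := (1 / 2 : ℝ)) (by norm_num)
    (by norm_num)).const_mul 2
  rw [mul_zero] at h
  refine h.congr fun k => ?_
  rw [cellRadius, one_div, inv_pow, div_eq_mul_inv]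

theorem cellRadius_pos (k : ℕ) : 0 < cellRadius k := by
  unfold cellRadius
  positivity

theorem exists_mem_cells_dist_lt_cellRadius (k : ℕ) (y : Cube n) :
    ∃ b ∈ cells n k, dist y (ballCenter n b) < cellRadius k := by
  obtain ⟨b, hb, h⟩ := exists_mem_cells k y
  exact ⟨b, hb, by linarith [cellRadius_eq_add k, cellRadius_pos (k + 1)]⟩

theorem touches_cells_iff {k b b' : ℕ} (hb : b ∈ cells n k) (hb' : b' ∈ cells n k) :
    Touches n b b' ↔
      dist (ballCenter n b) (ballCenter n b') ≤ cellRadius k + cellRadius k := by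
  rw [Touches, ballRadius_of_mem_cells hb, ballRadius_of_mem_cells hb', cellRadius]

theorem wellInside_cells_iff {k b b' : ℕ} (hb : b ∈ cells n (k + 1)) (hb' : b' ∈ cells n k) :
    WellInside n b b' ↔
      dist (ballCenter n b) (ballCenter n b') + cellRadius (k + 1) < cellRadius k := by
  rw [WellInside, ballRadius_of_mem_cells hb, ballRadius_of_mem_cells hb', cellRadius, cellRadius]

theorem exists_wellInside_cell (k b : ℕ) : ∃ b' ∈ cells n k,
    dist (ballCenter n b) (ballCenter n b') + cellRadius (k + 1) < cellRadius k := by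
  obtain ⟨b', hb', h⟩ := exists_mem_cells k (ballCenter n b)
  exact ⟨b', hb', by linarith [cellRadius_eq_add k]⟩

theorem WellInside.trans {a b b' : ℕ} (h : WellInside n a b) (h' : WellInside n b b') :
    WellInside n a b' := by
  unfold WellInside at *
  linarith [dist_triangle (ballCenter n a) (ballCenter n b) (ballCenter n b')]

/-- The cells of level `k` which are not excluded by the first `k` balls listed by `p`. -/
def aliveCells (n : ℕ) (p : Baire) (k : ℕ) : Set ℕ :=
  {b | b ∈ cells n k ∧ ¬ Excluded n (initSeg p k) b}

/-- A ball excluding `b'` also excludes the cell `b` well inside `b'`, and it is still listed at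
level `k + 1`. -/
theorem aliveCells_of_succ {p : Baire} {k b b' : ℕ} (hb : b ∈ aliveCells n p (k + 1))
    (hb' : b' ∈ cells n k)
    (h : dist (ballCenter n b) (ballCenter n b') + cellRadius (k + 1) < cellRadius k) :
    b' ∈ aliveCells n p k := by
  refine ⟨hb', fun ⟨e, he, hbe⟩ => hb.2 ⟨e, ?_, ((wellInside_cells_iff hb.1 hb').2 h).trans hbe⟩⟩
  rw [initSeg_succ]
  exact List.mem_append_left _ he

theorem mem_aliveCells_of_dist_le {p : Baire} {k : ℕ} {y : Cube n}
    (hy : y ∉ ⋃ i, ratBall n (p i)) {b : ℕ} (hb : b ∈ cells n k)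
    (h : dist y (ballCenter n b) ≤ cellRadius k) : b ∈ aliveCells n p k := by
  refine ⟨hb, ?_⟩
  rintro ⟨e, he, hbe⟩
  obtain ⟨i, -, rfl⟩ := mem_initSeg.1 he
  refine hy (Set.mem_iUnion.2 ⟨i, ?_⟩)
  rw [WellInside, ballRadius_of_mem_cells hb] at hbe
  rw [ratBall_eq, mem_ball]
  rw [cellRadius] at h
  linarith [dist_triangle y (ballCenter n b) (ballCenter n (p i))]

theorem exists_forall_aliveCells_lt_dist {p : Baire} {y : Cube n}
    (hy : y ∈ ⋃ i, ratBall n (p i)) :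
    ∃ k, ∀ b ∈ aliveCells n p k, cellRadius k < dist y (ballCenter n b) := by
  obtain ⟨i, hi⟩ := Set.mem_iUnion.1 hy
  rw [ratBall_eq, mem_ball] at hi
  -- Half of the slack suffices: a cell containing `y` has its center within one radius of `y` and
  -- extends one radius further.
  obtain ⟨k, hik, hk⟩ : ∃ k, i < k ∧
      cellRadius k < (ballRadius (p i) - dist y (ballCenter n (p i))) / 2 :=
    ((eventually_gt_atTop i).and
      (tendsto_cellRadius.eventually_lt_const (by linarith))).exists
  refine ⟨k, fun b hb => ?_⟩
  by_contra! hle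
  refine hb.2 ⟨p i, mem_initSeg.2 ⟨i, hik, rfl⟩, ?_⟩
  rw [WellInside, ballRadius_of_mem_cells hb.1, ← cellRadius]
  linarith [dist_triangle_left (ballCenter n b) (ballCenter n (p i)) y]

theorem selected_initSeg {x : ℕ → Bool} {i k b : ℕ} {v : Bool} :
    selected (initSeg x i) k b = some v ↔ Nat.pair k b < i ∧ x (Nat.pair k b) = v :=
  getElem?_initSeg_eq_some

theorem exists_pair_cells_lt (n k : ℕ) : ∃ N, ∀ i ≥ N, ∀ b ∈ cells n k, Nat.pair k b < i := by
  refine ⟨((cells n k).toFinset.sup fun b => Nat.pair k b) + 1, fun i hi b hb => ?_⟩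
  exact (Finset.le_sup (f := fun b => Nat.pair k b) (List.mem_toFinset.2 hb)).trans_lt hi

/-- A sequence of bits that always selects the cells linked with a point outside of the balls listed
by `p` is never forbidden. -/
theorem not_forbidden_of_chainComponent {p : Baire} {a : Cube n}
    (ha : a ∉ ⋃ i, ratBall n (p i)) {x : ℕ → Bool} (hx : ∀ k b, x (Nat.pair k b) = true ↔
      b ∈ chainComponent (ballCenter n) cellRadius (aliveCells n p) a k) (i : ℕ) :
    ¬ Forbidden n (initSeg p i) (initSeg x i) := by
  have hx' : ∀ k b, x (Nat.pair k b) = false ↔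
      b ∉ chainComponent (ballCenter n) cellRadius (aliveCells n p) a k := fun k b => by
    rw [← hx, Bool.not_eq_true]
  have hsub : ∀ {k b}, b ∈ chainComponent (ballCenter n) cellRadius (aliveCells n p) a k →
      b ∈ aliveCells n p k := fun h => chainComponent_subset h
  rintro ⟨k, hk, h⟩
  rw [length_initSeg] at hk
  rcases h with h | ⟨b, hb, hs, he⟩ | ⟨b, hb, b', hb', hs, hs', ht, he⟩ |
    ⟨b, hb, b', hb', hs, hs', hi⟩ | ⟨s, -, ⟨b, hb, hs, hbs⟩, ⟨b', hb', hs', hbs'⟩, hsep⟩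
  · obtain ⟨b, hb, hab⟩ := exists_mem_cells_dist_lt_cellRadius k a
    refine (hx' k b).1 (selected_initSeg.1 (h b hb)).2 ?_
    exact ⟨b, mem_aliveCells_of_dist_le ha hb hab.le, hab.le, .refl⟩
  · rw [take_initSeg p hk.le] at he
    exact (hsub ((hx k b).1 (selected_initSeg.1 hs).2)).2 he
  · rw [take_initSeg p hk.le] at he
    refine (hx' k b').1 (selected_initSeg.1 hs').2 ?_
    exact mem_chainComponent_of_dist_le ((hx k b).1 (selected_initSeg.1 hs).2) ⟨hb', he⟩
      ((touches_cells_iff hb hb').1 ht)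
  · refine (hx' k b').1 (selected_initSeg.1 hs').2 ?_
    exact mem_chainComponent_of_succ (I := fun k => {b | b ∈ cells n k})
      (fun b _ => exists_wellInside_cell k b) (fun b hb b' hb' => aliveCells_of_succ hb hb')
      ((hx _ b).1 (selected_initSeg.1 hs).2) hb' ((wellInside_cells_iff hb hb').1 hi)
  · refine hbs' (chainComponent_subset_of_closed (s := {b | b ∈ Denumerable.ofNat (List ℕ) s})
      ⟨b, (hx k b).1 (selected_initSeg.1 hs).2, hbs⟩ (fun c hc hcs c' hc' hcc' => ?_)
      ((hx k b').1 (selected_initSeg.1 hs').2))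
    by_contra hcs'
    rcases hsep c (hsub hc).1 c' (hsub hc').1 hcs hcs'
      ((touches_cells_iff (hsub hc).1 (hsub hc').1).2 hcc') with h | h
    · exact (hx' k c).1 (selected_initSeg.1 h).2 hc
    · exact (hx' k c').1 (selected_initSeg.1 h).2 hc'

/-- The cells of level `k` selected by a sequence of bits. -/
def selectedCells (n : ℕ) (x : ℕ → Bool) (k : ℕ) : Set ℕ :=
  {b | b ∈ cells n k ∧ x (Nat.pair k b) = true}

/-- Each clause of `Forbidden` refutes the failure of one condition on selections, once the prefix
is long enough to contain all bits of levels `k` and `k + 1` and the code of a separating list;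
`big` supplies such a length. -/
theorem isConnectednessComponent_of_not_forbidden {p : Baire} {x : ℕ → Bool}
    (h : ∀ i, ¬ Forbidden n (initSeg p i) (initSeg x i)) :
    ((⋃ k, ⋃ b ∈ {b | b ∈ cells n k} \ selectedCells n x k,
        ball (ballCenter n b) (cellRadius k))ᶜ).Nonempty ∧
      IsConnectednessComponent (⋃ k, ⋃ b ∈ {b | b ∈ cells n k} \ selectedCells n x k,
        ball (ballCenter n b) (cellRadius k))ᶜ (⋃ i, ratBall n (p i))ᶜ := by
  have big : ∀ k s, ∃ i, k < i ∧ s < i ∧ (∀ b ∈ cells n k, Nat.pair k b < i) ∧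
      ∀ b ∈ cells n (k + 1), Nat.pair (k + 1) b < i := by
    intro k s
    obtain ⟨N, hN⟩ := exists_pair_cells_lt n k
    obtain ⟨M, hM⟩ := exists_pair_cells_lt n (k + 1)
    exact ⟨k + 1 + s + 1 + N + M, by omega, by omega, hN _ (by omega), hM _ (by omega)⟩
  have notForb : ∀ {i k}, k < i → ∀ P : Prop, (P → NoneSelected n (initSeg x i) k ∨
      ExcludedSelected n (initSeg p i) (initSeg x i) k ∨
      NotTouchClosed n (initSeg p i) (initSeg x i) k ∨ NotLinked n (initSeg x i) k ∨
      ∃ s < (initSeg x i).length, SeparatedBy n (initSeg x i) k s) → ¬ P :=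
    fun {i k} hk P hP hp => h i ⟨k, by rwa [length_initSeg], hP hp⟩
  have hsub : ∀ k, selectedCells n x k ⊆ aliveCells n p k := by
    rintro k b ⟨hb, hxb⟩
    obtain ⟨i, hk, -, hi, -⟩ := big k 0
    refine ⟨hb, notForb hk _ fun he => Or.inr (Or.inl ⟨b, hb, ?_, ?_⟩)⟩
    · exact selected_initSeg.2 ⟨hi b hb, hxb⟩
    · rwa [take_initSeg p hk.le]
  have hlink : ∀ k, ∀ b ∈ selectedCells n x (k + 1), ∀ b' ∈ cells n k,
      dist (ballCenter n b) (ballCenter n b') + cellRadius (k + 1) < cellRadius k →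
        b' ∈ selectedCells n x k := by
    rintro k b ⟨hb, hxb⟩ b' hb' hbb'
    obtain ⟨i, hk, -, hi, hi'⟩ := big k 0
    refine ⟨hb', ?_⟩
    rw [← Bool.not_eq_false]
    refine notForb hk _ fun he => Or.inr (Or.inr (Or.inr (Or.inl ⟨b, hb, b', hb', ?_, ?_, ?_⟩)))
    · exact selected_initSeg.2 ⟨hi' b hb, hxb⟩
    · exact selected_initSeg.2 ⟨hi b' hb', he⟩
    · exact (wellInside_cells_iff hb hb').2 hbb'
  refine isConnectednessComponent_of_approximation (alive := aliveCells n p) tendsto_cellRadius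
    (fun k => ?_) exists_mem_cells_dist_lt_cellRadius (fun k b hb => hb.1)
    (fun k y hy b hb => mem_aliveCells_of_dist_le hy hb)
    (fun y hy => exists_forall_aliveCells_lt_dist (not_not.1 hy)) hsub (fun k => ?_)
    (fun k b hb b' hb' hbb' => ?_) (fun k b hb => ?_) fun k s ⟨a, ha, has⟩ ⟨b, hb, hbs⟩ => ?_
  · exact (List.finite_toSet (cells n k))
  · obtain ⟨i, hk, -, hi, -⟩ := big k 0
    by_contra hempty
    rw [Set.not_nonempty_iff_eq_empty] at hempty
    refine notForb hk True (fun _ => Or.inl fun b hb => ?_) trivial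
    refine selected_initSeg.2 ⟨hi b hb, ?_⟩
    rw [← Bool.not_eq_true]
    intro hxb
    exact (Set.ext_iff.1 hempty b).1 ⟨hb, hxb⟩
  · obtain ⟨i, hk, -, hi, -⟩ := big k 0
    refine ⟨hb'.1, ?_⟩
    rw [← Bool.not_eq_false]
    refine notForb hk _ fun he => Or.inr (Or.inr (Or.inl ⟨b, hb.1, b', hb'.1, ?_, ?_, ?_, ?_⟩))
    · exact selected_initSeg.2 ⟨hi b hb.1, hb.2⟩
    · exact selected_initSeg.2 ⟨hi b' hb'.1, he⟩
    · exact (touches_cells_iff hb.1 hb'.1).2 hbb'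
    · rw [take_initSeg p hk.le]
      exact hb'.2
  · obtain ⟨b', hb', hbb'⟩ := exists_wellInside_cell (n := n) k b
    exact ⟨b', hlink k b hb b' hb' hbb', hbb'.le⟩
  · by_contra! hno
    classical
    -- Only the cells of level `k` matter, so the arbitrary set `s` is replaced by a finite list
    -- with a code.
    set L := (cells n k).filter fun b => b ∈ s
    have hL : ∀ {c}, c ∈ cells n k → (c ∈ L ↔ c ∈ s) := fun hc => by simp [L, hc]
    obtain ⟨i, hk, hsi, hi, -⟩ := big k (Encodable.encode L)
    refine notForb hk True (fun _ => Or.inr (Or.inr (Or.inr (Or.inr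
      ⟨Encodable.encode L, by rwa [length_initSeg], ?_⟩)))) trivial
    rw [SeparatedBy, Denumerable.ofNat_encode]
    refine ⟨⟨a, ha.1, selected_initSeg.2 ⟨hi a ha.1, ha.2⟩, (hL ha.1).2 has⟩,
      ⟨b, hb.1, selected_initSeg.2 ⟨hi b hb.1, hb.2⟩, fun h => hbs ((hL hb.1).1 h)⟩,
      fun c hc c' hc' hcL hcL' ht => ?_⟩
    by_contra! hsel
    have hxt : ∀ {c}, c ∈ cells n k → selected (initSeg x i) k c ≠ some false →
        c ∈ selectedCells n x k := fun {c} hc hne => by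
      refine ⟨hc, ?_⟩
      rw [← Bool.not_eq_false]
      exact fun he => hne (selected_initSeg.2 ⟨hi c hc, he⟩)
    exact absurd ((touches_cells_iff hc hc').1 ht) (hno c (hxt hc hsel.1) ((hL hc).1 hcL) c'
      (hxt hc' hsel.2) fun h => hcL' ((hL hc').2 h)).not_ge

open Classical in
/-- The listing of all cells that are not selected. -/
noncomputable def unselectedBall (n : ℕ) (v j : ℕ) : ℕ :=
  if v = 0 ∧ j.unpair.2 ∈ cells n j.unpair.1 then j.unpair.2 else emptyBall

theorem primrec_unselectedBall (n : ℕ) :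
    Primrec₂ fun (u : List ℕ) (j : ℕ) => (u[j]?).map fun v => unselectedBall n v j := by
  classical
  have hj : Primrec fun x : (List ℕ × ℕ) × ℕ => x.1.2 := Primrec.snd.comp Primrec.fst
  exact Primrec.option_map Primrec.list_getElem? (Primrec.ite
    ((Primrec.eq.comp Primrec.snd (Primrec.const 0)).and
      (primrecPred_mem ((primrec_cells n).comp (primrec_fst_unpair hj)) (primrec_snd_unpair hj)))
    (primrec_snd_unpair hj) (Primrec.const _))

theorem iUnion_ratBall_unselectedBall {x : ℕ → Bool} {q : Baire} (hq : ∀ j, q j = (x j).toNat) :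
    ⋃ j, ratBall n (unselectedBall n (q j) j) =
      ⋃ k, ⋃ b ∈ {b | b ∈ cells n k} \ selectedCells n x k,
        ball (ballCenter n b) (cellRadius k) := by
  have hball : ∀ {k b}, b ∈ cells n k → ratBall n b = ball (ballCenter n b) (cellRadius k) :=
    fun hb => by rw [ratBall_eq, ballRadius_of_mem_cells hb, cellRadius]
  refine Set.Subset.antisymm (Set.iUnion_subset fun j => ?_) (Set.iUnion_subset fun k =>
    Set.iUnion₂_subset fun b hb => ?_)
  · rw [unselectedBall]
    split_ifs with hj
    · rw [hball hj.2]
      refine Set.subset_iUnion_of_subset j.unpair.1 (Set.subset_biUnion_of_mem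
        (u := fun b => ball (ballCenter n b) (cellRadius j.unpair.1)) ⟨hj.2, fun h => ?_⟩)
      have h2 := h.2
      rw [Nat.pair_unpair] at h2
      have h1 := hj.1
      rw [hq, h2] at h1
      simp at h1
    · rw [ratBall_emptyBall]
      exact Set.empty_subset _
  · refine Set.subset_iUnion_of_subset (Nat.pair k b) ?_
    have hx : x (Nat.pair k b) = false := by
      rw [← Bool.not_eq_true]
      exact fun h => hb.2 ⟨hb.1, h⟩
    rw [unselectedBall, if_pos, Nat.unpair_pair, hball hb.1]
    rw [Nat.unpair_pair, hq, hx]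
    exact ⟨rfl, hb.1⟩

theorem conComp_le_WKL (hn : 1 ≤ n) : StrongWeihrauchReducible (ConComp n) WKL := by
  classical
  refine strongWeihrauchReducible_of_pointwise
    (primrec_forbiddenTreeEntry (primrecRel_forbidden hn)) (primrec_unselectedBall n) ?_
  rintro p ⟨A, hne⟩ hp -
  change (A : Set (Cube n)) = (⋃ i, ratBall n (p i))ᶜ at hp
  obtain ⟨t, ht, htn⟩ := exists_name_forbiddenTree (Forbidden n) p
  obtain ⟨a, ha⟩ := hne
  have ha' : a ∉ ⋃ i, ratBall n (p i) := by
    rw [SetLike.mem_coe, ← SetLike.mem_coe, hp] at ha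
    exact ha
  -- This path only shows that the tree is infinite; it need not be computable.
  let x : ℕ → Bool := fun j => decide
    (j.unpair.2 ∈ chainComponent (ballCenter n) cellRadius (aliveCells n p) a j.unpair.1)
  have hx : ∀ k, initSeg x k ∈ (forbiddenTree (Forbidden n) p).carrier :=
    initSeg_mem_forbiddenTree.2 (not_forbidden_of_chainComponent ha' (by simp [x]))
  refine ⟨t, ht, ⟨forbiddenTree (Forbidden n) p, infinite_of_forall_initSeg_mem hx⟩, htn,
    ⟨x, hx⟩, fun q w hw hq => ?_⟩
  have hq' : ∀ j, q j = (w j).toNat := hq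
  have hcomp := isConnectednessComponent_of_not_forbidden (initSeg_mem_forbiddenTree.1 hw)
  rw [← iUnion_ratBall_unselectedBall hq', ← hp] at hcomp
  refine ⟨fun j => unselectedBall n (q j) j, mem_pointwise (fun m => ⟨m + 1, ?_⟩)
    (fun m k v h => ?_), ⟨⟨_, ?_⟩, hcomp.1⟩, hcomp.2, rfl⟩
  · rw [getElem?_initSeg, if_pos (Nat.lt_succ_self m)]
    rfl
  · rw [getElem?_initSeg] at h
    split_ifs at h
    · simpa using h.symm
    · simp at h
  · exact (isOpen_iUnion fun j => isOpen_ball).isClosed_compl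

end ComponentFromPath

/-! ## The Cantor set on the diagonal of the cube -/

section DiagonalCantor

open Filter Topology Metric

/-- The ternary digits of the point of the Cantor set given by a sequence of bits. -/
def cantorDigits (x : ℕ → Bool) (i : ℕ) : Fin 3 := cond (x i) 2 0

/-- The points on the diagonal of the cube with coordinates in the Cantor set. -/
noncomputable def diagonalCantor (n : ℕ) (x : ℕ → Bool) : Cube n := fun _ =>
  ⟨Real.ofDigits (cantorDigits x), Real.ofDigits_nonneg _, Real.ofDigits_le_one _⟩

theorem continuous_diagonalCantor (n : ℕ) : Continuous (diagonalCantor n) := by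
  refine continuous_pi fun _ => Continuous.subtype_mk (Real.continuous_ofDigits.comp ?_) _
  refine continuous_pi fun i => ?_
  exact (continuous_of_discreteTopology (f := fun b : Bool => (cond b 2 0 : Fin 3))).comp
    (continuous_apply i)

variable {n : ℕ}

theorem injective_diagonalCantor (hn : 1 ≤ n) : Function.Injective (diagonalCantor n) := by
  intro x y h
  have h0 := congrArg Subtype.val (congrFun h ⟨0, hn⟩)
  have ne_one : ∀ z : ℕ → Bool, ∀ i, cantorDigits z i ≠ 1 := fun z i => by
    unfold cantorDigits
    cases z i <;> simp
  have h1 := ofDigits_zero_two_sequence_unique (ne_one x) (ne_one y) h0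
  funext i
  have h2 := congrFun h1 i
  revert h2
  unfold cantorDigits
  cases x i <;> cases y i <;> simp

theorem dist_diagonalCantor_le {x y : ℕ → Bool} {k : ℕ} (h : ∀ i < k, x i = y i) :
    dist (diagonalCantor n x) (diagonalCantor n y) ≤ 1 / 3 ^ k := by
  rw [dist_pi_le_iff (by positivity)]
  intro i
  rw [Subtype.dist_eq, Real.dist_eq, one_div]
  have := Real.abs_ofDigits_sub_ofDigits_le (x := cantorDigits x) (y := cantorDigits y) (n := k)
    fun i hi => by simp only [cantorDigits, h i hi]
  exact_mod_cast this

/-- A word, continued by `false`. -/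
def padWord (w : List Bool) (i : ℕ) : Bool := w.getD i false

/-- The natural number with the ternary digits given by a word. -/
def ternaryCode (w : List Bool) : ℕ := w.foldl (fun a b => 3 * a + cond b 2 0) 0

theorem sum_ofDigitsTerm_padWord (w : List Bool) :
    ∑ i ∈ Finset.range w.length, Real.ofDigitsTerm (cantorDigits (padWord w)) i =
      (ternaryCode w : ℝ) / 3 ^ w.length := by
  induction w using List.reverseRecOn with
  | nil => simp [ternaryCode]
  | append_singleton w b ih =>
    have h1 : ∀ i ∈ Finset.range w.length, Real.ofDigitsTerm (cantorDigits (padWord (w ++ [b]))) i =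
        Real.ofDigitsTerm (cantorDigits (padWord w)) i := fun i hi => by
      rw [Finset.mem_range] at hi
      simp [Real.ofDigitsTerm, cantorDigits, padWord, List.getElem?_append, hi]
    have h2 : padWord (w ++ [b]) w.length = b := by simp [padWord]
    have h3 : ternaryCode (w ++ [b]) = 3 * ternaryCode w + cond b 2 0 := by simp [ternaryCode]
    rw [List.length_append, List.length_singleton, Finset.sum_range_succ,
      Finset.sum_congr rfl h1, ih, h3, Real.ofDigitsTerm, cantorDigits, h2]
    cases b
    · simp
      field_simp
      ring
    · simp
      field_simp
      ring

/-- The padded digits vanish, so the point is rational with denominator `3 ^ w.length` and can be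
the center of a coded ball. -/
theorem ofDigits_padWord (w : List Bool) :
    Real.ofDigits (cantorDigits (padWord w)) = (ternaryCode w : ℝ) / 3 ^ w.length := by
  rw [Real.ofDigits_eq_sum_add_ofDigits _ w.length, sum_ofDigitsTerm_padWord]
  have : (fun i => cantorDigits (padWord w) (i + w.length)) = fun _ => 0 := by
    funext i
    simp [cantorDigits, padWord]
  rw [this]
  simp [Real.ofDigits, Real.ofDigitsTerm]

theorem ternaryCode_le (w : List Bool) : ternaryCode w ≤ 3 ^ w.length := by
  have h := Real.ofDigits_le_one (cantorDigits (padWord w))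
  rw [ofDigits_padWord, div_le_one (by positivity)] at h
  exact_mod_cast h

/-- The code of a ball around the points of the Cantor set given by continuations of a word. -/
def wordBall (n : ℕ) (w : List Bool) : ℕ :=
  latticeBall (3 ^ w.length) (List.replicate n (ternaryCode w))

theorem ballCenter_wordBall (w : List Bool) :
    ballCenter n (wordBall n w) = diagonalCantor n (padWord w) := by
  funext i
  have hi : (List.replicate n (ternaryCode w)).getD i 0 = ternaryCode w := by simp
  apply Subtype.ext
  rw [wordBall, coe_ballCenter_latticeBall (by positivity) _ _ (hi.le.trans (ternaryCode_le w)), hi]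
  simp only [diagonalCantor, ofDigits_padWord]
  push_cast
  rfl

theorem ballRadius_wordBall (w : List Bool) : ballRadius (wordBall n w) = 2 / 3 ^ w.length := by
  rw [wordBall, ballRadius_latticeBall (by positivity)]
  push_cast
  rfl

theorem primrec_wordBall (n : ℕ) : Primrec (wordBall n) := by
  have hcode : Primrec ternaryCode := by
    have hc : Primrec fun b : Bool => (cond b 2 0 : ℕ) := Primrec.dom_bool _
    exact Primrec.list_foldl Primrec.id (Primrec.const 0) (Primrec.nat_add.comp
      (Primrec.nat_mul.comp (Primrec.const 3) (Primrec.fst.comp Primrec.snd))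
      (hc.comp (Primrec.snd.comp Primrec.snd))).to₂
  have hrep : Primrec fun w => List.replicate n (ternaryCode w) :=
    (Primrec.list_map (Primrec.const (List.range n)) (hcode.comp Primrec.fst).to₂).of_eq
      fun w => by simp [List.map_const']
  exact primrec_latticeBall.comp (primrec_pow.comp (Primrec.const 3) Primrec.list_length) hrep

theorem padWord_initSeg {x : ℕ → Bool} {k i : ℕ} (hi : i < k) : padWord (initSeg x k) i = x i := by
  rw [padWord, List.getD_eq_getElem?_getD, getElem?_initSeg, if_pos hi]
  rfl

theorem initSeg_padWord (w : List Bool) : initSeg (padWord w) w.length = w := by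
  refine List.ext_getElem? fun i => ?_
  rw [getElem?_initSeg]
  split_ifs with h
  · simp [padWord, h]
  · simp [not_lt.1 h]

theorem dist_ballCenter_wordBall_le (x : ℕ → Bool) (k : ℕ) :
    dist (diagonalCantor n x) (ballCenter n (wordBall n (initSeg x k))) ≤ 1 / 3 ^ k := by
  rw [ballCenter_wordBall]
  exact dist_diagonalCantor_le fun i hi => (padWord_initSeg hi).symm

theorem dist_ballCenter_wordBall_succ_le (x : ℕ → Bool) (k : ℕ) :
    dist (ballCenter n (wordBall n (initSeg x (k + 1))))
      (ballCenter n (wordBall n (initSeg x k))) ≤ 1 / 3 ^ k := by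
  rw [ballCenter_wordBall, ballCenter_wordBall]
  exact dist_diagonalCantor_le fun i hi => by
    rw [padWord_initSeg hi, padWord_initSeg (hi.trans (Nat.lt_succ_self k))]

/-! ### Clopen conditions on prefixes, and the scale `1 / 3 ^ k` -/

theorem isOpen_setOf_initSeg (P : List Bool → Prop) (k : ℕ) :
    IsOpen {x : ℕ → Bool | P (initSeg x k)} := by
  refine isOpen_iff_forall_mem_open.2 fun x hx =>
    ⟨PiNat.cylinder x k, fun y hy => ?_, PiNat.isOpen_cylinder _ x k, PiNat.self_mem_cylinder x k⟩
  have : initSeg y k = initSeg x k := by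
    refine List.map_congr_left fun i hi => ?_
    exact hy i (List.mem_range.1 hi)
  change P _
  rwa [this]

theorem isClosed_setOf_initSeg (P : List Bool → Prop) (k : ℕ) :
    IsClosed {x : ℕ → Bool | P (initSeg x k)} :=
  ⟨isOpen_setOf_initSeg (fun w => ¬ P w) k⟩

theorem three_pow_inv_succ (k : ℕ) : (1 : ℝ) / 3 ^ k = 3 * (1 / 3 ^ (k + 1)) := by
  field_simp
  ring

theorem tendsto_three_pow_inv : Tendsto (fun k : ℕ => (1 : ℝ) / 3 ^ k) atTop (𝓝 0) := by
  refine (tendsto_pow_atTop_nhds_zero_of_lt_one (r := (1 / 3 : ℝ)) (by norm_num)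
    (by norm_num)).congr fun k => ?_
  rw [one_div, one_div, inv_pow]

/-! ### Closed sets of paths -/

/-- The infinite paths of a binary tree. -/
def paths (T : BinaryTree) : Set (ℕ → Bool) := {x | ∀ k, initSeg x k ∈ T.carrier}

theorem isClosed_paths (T : BinaryTree) : IsClosed (paths T) := by
  rw [paths, Set.ofPred_forall]
  exact isClosed_iInter fun k => isClosed_setOf_initSeg (fun w => w ∈ T.carrier) k

/-- Otherwise the sequences whose prefix of length `k` is in the tree and has a ball touching `m`
form a decreasing sequence of nonempty closed sets. A common element is a path whose point lies in
the closed ball `m`. -/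
theorem exists_level_not_touches {T : BinaryTree} {m : ℕ}
    (hm : ∀ x ∈ paths T, ballRadius m < dist (ballCenter n m) (diagonalCantor n x)) :
    ∃ k, ∀ w ∈ T.carrier, w.length = k → ¬ Touches n m (wordBall n w) := by
  by_contra! hno
  let P : ℕ → Set (ℕ → Bool) := fun k =>
    {x | initSeg x k ∈ T.carrier ∧ Touches n m (wordBall n (initSeg x k))}
  have hsucc : ∀ k, P (k + 1) ⊆ P k := by
    rintro k x ⟨hx, ht⟩
    refine ⟨T.prefix_closed _ _ (initSeg_prefix x (Nat.le_succ k)) hx, ?_⟩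
    rw [Touches, ballRadius_wordBall, length_initSeg] at ht ⊢
    have h1 := dist_triangle (ballCenter n m) (ballCenter n (wordBall n (initSeg x (k + 1))))
      (ballCenter n (wordBall n (initSeg x k)))
    have h2 := dist_ballCenter_wordBall_succ_le (n := n) x k
    -- Radius `2 / 3 ^ k` makes word balls nested: in units of `1 / 3 ^ (k + 1)`, the inner radius
    -- `2` plus the shift `3` of the center is at most `6`.
    have h3 := three_pow_inv_succ k
    have h4 : (0 : ℝ) ≤ 1 / 3 ^ (k + 1) := by positivity
    rw [← mul_one_div] at ht ⊢
    linarith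
  have hclosed : ∀ k, IsClosed (P k) := fun k =>
    isClosed_setOf_initSeg (fun w => w ∈ T.carrier ∧ Touches n m (wordBall n w)) k
  have hne : ∀ k, (P k).Nonempty := fun k => by
    obtain ⟨w, hw, rfl, ht⟩ := hno k
    refine ⟨padWord w, ?_⟩
    change _ ∧ _
    rw [initSeg_padWord]
    exact ⟨hw, ht⟩
  obtain ⟨x, hx⟩ := IsCompact.nonempty_iInter_of_sequence_nonempty_isCompact_isClosed P hsucc hne
    (hclosed 0).isCompact hclosed
  rw [Set.mem_iInter] at hx
  have hlt := hm x fun k => (hx k).1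
  obtain ⟨k, hk⟩ := (tendsto_three_pow_inv.eventually_lt_const (show 0 <
    (dist (ballCenter n m) (diagonalCantor n x) - ballRadius m) / 3 by linarith)).exists
  have h1 := (hx k).2
  rw [Touches, ballRadius_wordBall, length_initSeg, ← mul_one_div] at h1
  have h2 := dist_ballCenter_wordBall_le (n := n) x k
  have h3 := dist_triangle_right (ballCenter n m) (diagonalCantor n x)
    (ballCenter n (wordBall n (initSeg x k)))
  linarith

/-- Even the closed ball has to avoid `K`, so that finitely many word balls can witness it; a
quarter of the free radius is left over. -/
theorem exists_ratBall_of_not_mem {K : Set (Cube n)} (hK : IsClosed K) {y : Cube n} (hy : y ∉ K) :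
    ∃ m, y ∈ ratBall n m ∧ ∀ z ∈ K, ballRadius m < dist (ballCenter n m) z := by
  obtain ⟨ε, hε, h⟩ := Metric.isOpen_iff.1 hK.isOpen_compl y hy
  obtain ⟨c, hc⟩ := exists_ratPoint y (show 0 < ε / 4 by linarith)
  obtain ⟨r, hr1, hr2⟩ := exists_ratCode (show 0 ≤ ε / 4 by linarith)
    (show ε / 4 < ε / 2 by linarith)
  refine ⟨Nat.pair c r, ?_, fun z hz => ?_⟩
  · rw [ratBall, Nat.unpair_pair, mem_ball]
    exact hc.trans hr1
  · rw [ballRadius, ballCenter, Nat.unpair_pair]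
    dsimp only
    by_contra! hle
    refine h (mem_ball.2 ?_) hz
    rw [dist_comm]
    linarith [dist_triangle y (ratPoint n c) z]

open Classical in
/-- A ball of a listing of the complement of the points given by the paths of a tree, whose name
is `t`. -/
noncomputable def avoidingBall (n : ℕ) (t : ℕ → ℕ) (j : ℕ) : ℕ :=
  if ∀ w ∈ binaryWords j.unpair.2, t (Encodable.encode w) = 0 ∨
    ¬ Touches n j.unpair.1 (wordBall n w) then j.unpair.1 else emptyBall

/-- The index `j` codes a ball and a level, and the ball is listed if no word of the tree at that
level has a ball touching it. A ball containing the point of a path is never listed, as it touches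
all word balls along the path; every other point is caught at some level by
`exists_level_not_touches`. -/
theorem image_paths_eq {T : BinaryTree} {t : Baire} (ht : RepresentedSpace.Names t T) :
    diagonalCantor n '' paths T = (⋃ j, ratBall n (avoidingBall n t j))ᶜ := by
  have hmem : ∀ w : List Bool, t (Encodable.encode w) = 0 ↔ w ∉ T.carrier := by
    intro w
    have := ht (Encodable.encode w)
    constructor
    · intro h0 hw
      rw [this.1 ⟨w, hw, rfl⟩] at h0
      cases h0
    · refine fun hw => this.2 ?_
      rintro ⟨v, hv, hvw⟩
      exact hw (Encodable.encode_injective hvw ▸ hv)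
  rw [eq_compl_comm]
  refine Set.Subset.antisymm (Set.iUnion_subset fun j => ?_) fun y hy => ?_
  · rw [avoidingBall]
    split_ifs with hj
    · rintro _ hy ⟨x, hx, rfl⟩
      rcases hj (initSeg x j.unpair.2) (mem_binaryWords.2 (length_initSeg _ _)) with h | h
      · exact (hmem _).1 h (hx _)
      · refine h ?_
        rw [ratBall_eq, mem_ball] at hy
        rw [Touches, ballRadius_wordBall, length_initSeg, ← mul_one_div]
        have h1 := dist_ballCenter_wordBall_le (n := n) x j.unpair.2
        have h2 := dist_triangle_left (ballCenter n j.unpair.1)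
          (ballCenter n (wordBall n (initSeg x j.unpair.2))) (diagonalCantor n x)
        have h3 : (0 : ℝ) ≤ 1 / 3 ^ j.unpair.2 := by positivity
        linarith
    · rw [ratBall_emptyBall]
      exact Set.empty_subset _
  · have hK : IsClosed (diagonalCantor n '' paths T) :=
      ((isClosed_paths T).isCompact.image (continuous_diagonalCantor n)).isClosed
    obtain ⟨m, hym, hm⟩ := exists_ratBall_of_not_mem hK hy
    obtain ⟨k, hk⟩ := exists_level_not_touches (T := T) (m := m)
      fun x hx => hm _ (Set.mem_image_of_mem _ hx)
    refine Set.mem_iUnion.2 ⟨Nat.pair m k, ?_⟩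
    rw [avoidingBall, if_pos, Nat.unpair_pair]
    · exact hym
    · rw [Nat.unpair_pair]
      intro w hw
      rw [hmem]
      by_cases hwT : w ∈ T.carrier
      · exact Or.inr (hk w hwT (mem_binaryWords.1 hw))
      · exact Or.inl hwT

/-- Prefixes of a name of a tree determine the listing of balls entry by entry. -/
noncomputable def avoidingBallEntry (n : ℕ) (u : List ℕ) (j : ℕ) : Option ℕ :=
  open Classical in
  if ∀ w ∈ binaryWords j.unpair.2, Encodable.encode w < u.length then
    some (avoidingBall n (fun i => u.getD i 0) j) else none

theorem primrec_avoidingBallEntry (n : ℕ) : Primrec₂ (avoidingBallEntry n) := by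
  classical
  have hj : Primrec fun x : List ℕ × ℕ => x.2 := Primrec.snd
  have hwords : Primrec fun x : List ℕ × ℕ => binaryWords x.2.unpair.2 :=
    primrec_binaryWords.comp (primrec_snd_unpair hj)
  have henc : Primrec fun x : (List ℕ × ℕ) × List Bool => Encodable.encode x.2 :=
    Primrec.encode.comp Primrec.snd
  have hu : Primrec fun x : (List ℕ × ℕ) × List Bool => x.1.1 := Primrec.fst.comp Primrec.fst
  have h1 := primrecPred_forall_mem hwords
    (p := fun x w => Encodable.encode w < x.1.length)
    (Primrec.nat_lt.comp henc (Primrec.list_length.comp hu))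
  have h2 := primrecPred_forall_mem hwords
    (p := fun x w => x.1.getD (Encodable.encode w) 0 = 0 ∨
      ¬ Touches n x.2.unpair.1 (wordBall n w))
    ((Primrec.eq.comp ((Primrec.list_getD 0).comp hu henc) (Primrec.const 0)).or
      ((primrecRel_touches n).comp (primrec_fst_unpair (hj.comp Primrec.fst))
        ((primrec_wordBall n).comp Primrec.snd)).not)
  exact Primrec.ite h1 (Primrec.option_some.comp
    (Primrec.ite h2 (primrec_fst_unpair hj) (Primrec.const _))) (Primrec.const _)

theorem avoidingBall_mem_pointwise (n : ℕ) (t : Baire) :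
    avoidingBall n t ∈ pointwise (avoidingBallEntry n) t := by
  have key : ∀ k j, (∀ w ∈ binaryWords j.unpair.2, Encodable.encode w < k) →
      avoidingBall n (fun i => (initSeg t k).getD i 0) j = avoidingBall n t j := by
    intro k j h
    have : ∀ w ∈ binaryWords j.unpair.2,
        (initSeg t k).getD (Encodable.encode w) 0 = t (Encodable.encode w) := fun w hw => by
      rw [List.getD_eq_getElem?_getD, getElem?_initSeg, if_pos (h w hw)]
      rfl
    unfold avoidingBall
    congr 1
    refine propext (forall₂_congr fun w hw => ?_)
    simp only [this w hw]
  refine mem_pointwise (fun j => ?_) fun j k a h => ?_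
  · have hk : ∀ w ∈ binaryWords j.unpair.2, Encodable.encode w <
        ((binaryWords j.unpair.2).toFinset.sup fun w => Encodable.encode w) + 1 := fun w hw =>
      Nat.lt_succ_of_le (Finset.le_sup (f := fun w : List Bool => Encodable.encode w)
        (List.mem_toFinset.2 hw))
    refine ⟨((binaryWords j.unpair.2).toFinset.sup fun w => Encodable.encode w) + 1, ?_⟩
    rw [avoidingBallEntry, length_initSeg, if_pos hk, key _ j hk]
  · rw [avoidingBallEntry, length_initSeg] at h
    split_ifs at h with h1
    rw [key k j h1] at h
    exact (Option.some.inj h).symm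

/-! ### Reading off a path from its point -/

/-- The balls in `u` exclude all words whose entry `m` differs from `c`. -/
def DecidesEntry (n : ℕ) (u : List ℕ) (m : ℕ) (c : Bool) : Prop :=
  m < u.length ∧ ∀ w ∈ binaryWords u.length, w[m]? = some (!c) → Excluded n u (wordBall n w)

open Classical in
/-- The entries of a path, computed from prefixes of a name of its point. -/
noncomputable def pathEntry (n : ℕ) (u : List ℕ) (m : ℕ) : Option ℕ :=
  if DecidesEntry n u m false then some 0 else if DecidesEntry n u m true then some 1 else none

theorem primrec_pathEntry (hn : 1 ≤ n) : Primrec₂ (pathEntry n) := by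
  classical
  have hd : ∀ c, PrimrecPred fun x : List ℕ × ℕ => DecidesEntry n x.1 x.2 c := by
    intro c
    have hu : Primrec fun x : (List ℕ × ℕ) × List Bool => x.1.1 := Primrec.fst.comp Primrec.fst
    have hm : Primrec fun x : (List ℕ × ℕ) × List Bool => x.1.2 := Primrec.snd.comp Primrec.fst
    have h1 := Primrec.eq.comp (Primrec.list_getElem?.comp Primrec.snd hm)
      (Primrec.const (some (!c)))
    have h2 := (primrecRel_excluded hn).comp hu ((primrec_wordBall n).comp Primrec.snd)
    have h3 := primrecPred_forall_mem (f := fun x : List ℕ × ℕ => binaryWords x.1.length)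
      (primrec_binaryWords.comp (Primrec.list_length.comp Primrec.fst))
      (p := fun x w => w[x.2]? = some (!c) → Excluded n x.1 (wordBall n w))
      ((h1.not.or h2).of_eq fun x => imp_iff_not_or.symm)
    exact (Primrec.nat_lt.comp Primrec.snd (Primrec.list_length.comp Primrec.fst)).and h3
  exact Primrec.ite (hd false) (Primrec.const _)
    (Primrec.ite (hd true) (Primrec.const _) (Primrec.const _))

/-- A wrong decision would exclude the prefix of `x` itself, whose word ball contains the point of
`x`, and so put this point into a listed ball. -/
theorem decidesEntry_sound {q : Baire} {x : ℕ → Bool}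
    (hq : diagonalCantor n x ∉ ⋃ i, ratBall n (q i)) {k m : ℕ} {c : Bool}
    (h : DecidesEntry n (initSeg q k) m c) : c = x m := by
  obtain ⟨hm, hall⟩ := h
  rw [length_initSeg] at hm hall
  by_contra hne
  obtain ⟨e, he, hwe⟩ := hall (initSeg x k) (mem_binaryWords.2 (length_initSeg _ _)) (by
    rw [getElem?_initSeg, if_pos hm]
    revert hne
    cases c <;> cases x m <;> simp)
  obtain ⟨i, -, rfl⟩ := mem_initSeg.1 he
  refine hq (Set.mem_iUnion.2 ⟨i, ?_⟩)
  rw [WellInside, ballRadius_wordBall, length_initSeg, ← mul_one_div] at hwe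
  rw [ratBall_eq, mem_ball]
  have h1 := dist_ballCenter_wordBall_le (n := n) x k
  have h2 := dist_triangle (diagonalCantor n x) (ballCenter n (wordBall n (initSeg x k)))
    (ballCenter n (q i))
  have h3 : (0 : ℝ) ≤ 1 / 3 ^ k := by positivity
  linarith

/-- The sequences with the wrong bit at `m` form a compact set. By injectivity their points differ
from that of `x`, so each has a prefix excluded at some stage; the open sets `O k` increase, so one
stage serves all. -/
theorem exists_decidesEntry (hn : 1 ≤ n) {q : Baire} {x : ℕ → Bool}
    (hq : {diagonalCantor n x} = (⋃ i, ratBall n (q i))ᶜ) (m : ℕ) :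
    ∃ k, DecidesEntry n (initSeg q k) m (x m) := by
  let O : ℕ → Set (ℕ → Bool) := fun k =>
    {y | Excluded n (initSeg q k) (wordBall n (initSeg y k))}
  have hO : ∀ k, IsOpen (O k) := fun k =>
    isOpen_setOf_initSeg (fun w => Excluded n (initSeg q k) (wordBall n w)) k
  have hmono : Monotone O := by
    refine monotone_nat_of_le_succ fun k y => ?_
    rintro ⟨e, he, hwe⟩
    refine ⟨e, (initSeg_prefix q (Nat.le_succ k)).subset he, ?_⟩
    rw [WellInside, ballRadius_wordBall, length_initSeg, ← mul_one_div] at hwe ⊢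
    have h1 := dist_triangle (ballCenter n (wordBall n (initSeg y (k + 1))))
      (ballCenter n (wordBall n (initSeg y k))) (ballCenter n e)
    have h2 := dist_ballCenter_wordBall_succ_le (n := n) y k
    have h3 := three_pow_inv_succ k
    have h4 : (0 : ℝ) ≤ 1 / 3 ^ (k + 1) := by positivity
    linarith
  have hZ : IsCompact {y : ℕ → Bool | y m = !x m} :=
    (isClosed_eq (continuous_apply m) continuous_const).isCompact
  obtain ⟨k₀, hk₀⟩ := hZ.elim_directed_cover O hO (fun y hy => by
    have hne : diagonalCantor n y ∉ ({diagonalCantor n x} : Set (Cube n)) := by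
      intro h
      rw [injective_diagonalCantor hn h] at hy
      change x m = !x m at hy
      cases x m <;> simp at hy
    rw [hq, Set.notMem_compl_iff] at hne
    obtain ⟨i, hi⟩ := Set.mem_iUnion.1 hne
    rw [ratBall_eq, mem_ball] at hi
    obtain ⟨k, hik, hk⟩ := ((eventually_gt_atTop i).and
      (tendsto_three_pow_inv.eventually_lt_const (show 0 < (ballRadius (q i) -
        dist (diagonalCantor n y) (ballCenter n (q i))) / 3 by linarith))).exists
    refine Set.mem_iUnion.2 ⟨k, q i, mem_initSeg.2 ⟨i, hik, rfl⟩, ?_⟩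
    rw [WellInside, ballRadius_wordBall, length_initSeg, ← mul_one_div]
    have h1 := dist_ballCenter_wordBall_le (n := n) y k
    have h2 := dist_triangle_left (ballCenter n (wordBall n (initSeg y k)))
      (ballCenter n (q i)) (diagonalCantor n y)
    linarith) (directed_of_isDirected_le hmono)
  refine ⟨max k₀ (m + 1), ?_, fun w hw hwm => ?_⟩
  · rw [length_initSeg]
    omega
  · rw [length_initSeg, mem_binaryWords] at hw
    have hy : padWord w ∈ {y : ℕ → Bool | y m = !x m} := by
      change w.getD m false = _
      rw [List.getD_eq_getElem?_getD, hwm]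
      rfl
    have h : Excluded n (initSeg q (max k₀ (m + 1)))
        (wordBall n (initSeg (padWord w) (max k₀ (m + 1)))) := hmono (le_max_left _ _) (hk₀ hy)
    rwa [← hw, initSeg_padWord, hw] at h

theorem path_mem_pointwise (hn : 1 ≤ n) {q : Baire} {x : ℕ → Bool}
    (hq : {diagonalCantor n x} = (⋃ i, ratBall n (q i))ᶜ) :
    (fun m => (x m).toNat) ∈ pointwise (pathEntry n) q := by
  have hx : diagonalCantor n x ∈ (⋃ i, ratBall n (q i))ᶜ := hq ▸ Set.mem_singleton _
  have hsound : ∀ {k m c}, DecidesEntry n (initSeg q k) m c → c = x m := fun h =>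
    decidesEntry_sound hx h
  refine mem_pointwise (fun m => ?_) fun m k a h => ?_
  · obtain ⟨k, hk⟩ := exists_decidesEntry hn hq m
    refine ⟨k, ?_⟩
    rw [pathEntry]
    cases hxm : x m
    · rw [hxm] at hk
      rw [if_pos hk]
      rfl
    · rw [hxm] at hk
      rw [if_neg fun h => by simpa [hxm] using hsound h, if_pos hk]
      rfl
  · rw [pathEntry] at h
    split_ifs at h with h0 h1
    · rw [← hsound h0]
      exact (Option.some.inj h).symm
    · rw [← hsound h1]
      exact (Option.some.inj h).symm

/-- The Cantor set on the diagonal is homeomorphic to the totally disconnected space of bit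
sequences. -/
theorem subsingleton_of_isPreconnected_of_subset (hn : 1 ≤ n) {S : Set (Cube n)}
    (hS : S ⊆ Set.range (diagonalCantor n)) (hc : IsPreconnected S) : S.Subsingleton := by
  have hemb := (continuous_diagonalCantor n).isClosedEmbedding (injective_diagonalCantor hn)
  rw [← Set.image_preimage_eq_of_subset hS, hemb.isInducing.isPreconnected_image] at hc
  rw [← Set.image_preimage_eq_of_subset hS]
  exact hc.subsingleton.image _

theorem WKL_le_conComp (hn : 1 ≤ n) : StrongWeihrauchReducible WKL (ConComp n) := by
  refine strongWeihrauchReducible_of_pointwise (primrec_avoidingBallEntry n)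
    (primrec_pathEntry hn) ?_
  rintro t ⟨T, hT⟩ ht ⟨x₀, hx₀⟩
  have hA := image_paths_eq (n := n) ht
  have hrange : diagonalCantor n '' paths T ⊆ Set.range (diagonalCantor n) :=
    Set.image_subset_range _ _
  let A : NonemptyClosed n := ⟨⟨diagonalCantor n '' paths T,
    ((isClosed_paths T).isCompact.image (continuous_diagonalCantor n)).isClosed⟩,
    ⟨_, Set.mem_image_of_mem _ hx₀⟩⟩
  refine ⟨avoidingBall n t, avoidingBall_mem_pointwise n t, A, hA, ?_, fun q C hC hq => ?_⟩
  · refine ⟨⟨⟨{diagonalCantor n x₀}, isClosed_singleton⟩, Set.singleton_nonempty _⟩,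
      ⟨Set.singleton_subset_iff.2 (Set.mem_image_of_mem _ hx₀), isPreconnected_singleton⟩, ?_⟩
    rintro S ⟨hSA, hS⟩ hxS y hy
    exact subsingleton_of_isPreconnected_of_subset hn (hSA.trans hrange) hS hy
      (hxS (Set.mem_singleton _))
  · obtain ⟨y, hy⟩ := C.2
    obtain ⟨x, hx, rfl⟩ := hC.1.1 hy
    have hCx : (C.1 : Set (Cube n)) = {diagonalCantor n x} :=
      (subsingleton_of_isPreconnected_of_subset hn (hC.1.1.trans hrange)
        hC.1.2).eq_singleton_of_mem hy
    have hq' : (C.1 : Set (Cube n)) = (⋃ i, ratBall n (q i))ᶜ := hq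
    exact ⟨_, path_mem_pointwise hn (hCx ▸ hq'), x, hx, fun _ => rfl⟩

end DiagonalCantor

end CompAnalysis

open CompAnalysis

theorem theorem3p6 (n : ℕ) (hn : 1 ≤ n) : StrongWeihrauchEquiv (ConComp n) WKL :=
  ⟨conComp_le_WKL hn, WKL_le_conComp hn⟩
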